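/- Let $M=(\mathcal S,\mathcal A,r,p)$ be a Markov decision process (MDP) with nonempty finite sets of $S$ states and $A$ actions, rewards $r:\mathcal S\times\mathcal A\to[0,1]$ and transition probabilities $p(\cdot\mid s,a)$. For $\pi:\mathcal S\to\mathcal A$ let $$J^\pi(s)=\liminf_{T\to\infty}\frac1T\,\mathbb E\Big[\sum_{t=1}^T r(s_t,\pi(s_t))\,\Big|\,s_1=s\Big],\quad s_{t+1}\sim p(\cdot\mid s_t,\pi(s_t)),\qquad J^*(s)=\max_\pi J^\pi(s).$$ $M$ is weakly communicating if $\mathcal S$ can be partitioned into two subsets such that all states of the first are transient under every stationary policy, and every two states of the second are accessible from each other under some stationary policy. Optimistic Q-learning with horizon $T\in\mathbb N$, parameters $H\ge 2$, $\delta\in(0,1)$, $\sigma\ge 0$ and known $r$ is the following algorithm. Put $\gamma=1-\frac1H$, $\alpha_\tau=\frac{H+1}{H+\tau}$, $b_\tau=4\sigma\sqrt{\frac H\tau\ln\frac{2T}\delta}$, and start with $\hat V_1(s)=Q_1(s,a)=\hat Q_1(s,a)=H$ and $n_1(s,a)=0$ for all $s,a$. For $t=1,\dots,T$: in state $s_t$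 take an action $a_t\in\arg\max_a\hat Q_t(s_t,a)$ (ties broken arbitrarily as a function of the history), observe $s_{t+1}\sim p(\cdot\mid s_t,a_t)$, put $\tau=n_{t+1}(s_t,a_t)=n_t(s_t,a_t)+1$ and $$Q_{t+1}(s_t,a_t)=(1-\alpha_\tau)Q_t(s_t,a_t)+\alpha_\tau\big[r(s_t,a_t)+\gamma\hat V_t(s_{t+1})+b_\tau\big],$$ $$\hat Q_{t+1}(s_t,a_t)=\min\{\hat Q_t(s_t,a_t),Q_{t+1}(s_t,a_t)\},\qquad \hat V_{t+1}(s_t)=\max_a\hat Q_{t+1}(s_t,a),$$ all other entries being unchanged. **Theorem.** There is a universal constant $K>0$ such that the following holds for every weakly communicating MDP $M$. There are $J^*\in\mathbb R$ and $q^*:\mathcal S\times\mathcal A\to\mathbb R$ such that $J^*(s)=J^*$ for all $s$ and $$J^*+q^*(s,a)=r(s,a)+\mathbb E_{s'\sim p(\cdot\mid s,a)}[v^*(s')]\ \text{ for all }s,a,\qquad v^*(s)=\max_a q^*(s,a).$$ For every such $J^*,q^*$, with $\mathrm{sp}(v^*)=\max_s v^*(s)-\min_s v^*(s)$, for every initial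 state $s_1$, every $T\in\mathbb N$ and every $\delta\in(0,1)$ for which $$H=\min\left\{\sqrt{\frac{\mathrm{sp}(v^*)\,T}{SA}},\ \left(\frac{T}{SA\ln\frac{4T}\delta}\right)^{1/3}\right\}\ge 2,$$ Optimistic Q-learning with this $H$ and with $\sigma=\mathrm{sp}(v^*)$ satisfies, with probability at least $1-\delta$, $$\sum_{t=1}^T\big(J^*-r(s_t,a_t)\big)\le K\left(\sqrt{\mathrm{sp}(v^*)SAT}+\mathrm{sp}(v^*)\Big(T^{2/3}\big(SA\ln\tfrac T\delta\big)^{1/3}+\sqrt{T\ln\tfrac1\delta}\Big)\right).$$ -/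

import Mathlib

noncomputable section

/-- A Markov decision process with state space `S` and action space `A`: rewards in `[0, 1]` and
transition laws `p(· | s, a)`. -/
structure MDP (S A : Type*) where
  r : S → A → ℝ
  r_mem : ∀ s a, r s a ∈ Set.Icc (0 : ℝ) 1
  p : S → A → PMF S

namespace MDP

variable {S A : Type*} [Fintype S] [Fintype A] [DecidableEq S] [DecidableEq A]

/-- The transition matrix `P^π(s, s') = p(s' | s, π(s))` of a stationary policy `π : S → A`. -/
def transMatrix (M : MDP S A) (π : S → A) : Matrix S S ℝ :=
  fun s s' => (M.p s (π s) s').toReal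

/-- `𝔼[r(s_{t+1}, π(s_{t+1})) | s_1 = s]` under `π`, that is `((P^π)^t r^π)(s)`. -/
def expectedReward (M : MDP S A) (π : S → A) (t : ℕ) (s : S) : ℝ :=
  ∑ s', (M.transMatrix π ^ t) s s' * M.r s' (π s')

/-- The average reward `J^π(s) = liminf_{T → ∞} (1/T) 𝔼[∑_{t=1}^T r(s_t, π(s_t)) | s_1 = s]`. -/
def avgReward (M : MDP S A) (π : S → A) (s : S) : ℝ :=
  Filter.liminf
    (fun T : ℕ => (1 / (T : ℝ)) * ∑ t ∈ Finset.range T, M.expectedReward π t s) Filter.atTop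

/-- The optimal average reward `J^*(s) = max_π J^π(s)` (a maximum over a finite set). -/
def optAvgReward (M : MDP S A) (s : S) : ℝ :=
  ⨆ π : S → A, M.avgReward π s

/-- The state `s` is transient under `π`: the expected number of visits to `s` of the chain started
at `s` is finite. -/
def IsTransient (M : MDP S A) (π : S → A) (s : S) : Prop :=
  Summable fun n : ℕ => (M.transMatrix π ^ n) s s

/-- The state `s'` is accessible from `s` under `π`. -/
def IsAccessible (M : MDP S A) (π : S → A) (s s' : S) : Prop :=
  ∃ n : ℕ, 0 < (M.transMatrix π ^ n) s s'

/-- The states can be partitioned into a set `C` in which every two states are accessible from each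
other under some stationary policy, and its complement, in which all states are transient under
every stationary policy. -/
def IsWeaklyCommunicating (M : MDP S A) : Prop :=
  ∃ C : Set S, (∀ s, s ∉ C → ∀ π : S → A, M.IsTransient π s) ∧
    ∀ s ∈ C, ∀ s' ∈ C, ∃ π : S → A, M.IsAccessible π s s'

/-- The state values `v(s) = max_a q(s, a)` of `q` (a maximum over a finite set). -/
def maxValue (q : S → A → ℝ) (s : S) : ℝ :=
  ⨆ a, q s a

/-- The span `max_s v(s) - min_s v(s)`. -/
def span (v : S → ℝ) : ℝ :=
  (⨆ s, v s) - ⨅ s, v s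

/-- `J` is the optimal average reward from every state, and `(J, q)` solves the average-reward
Bellman optimality equation `J + q(s, a) = r(s, a) + 𝔼_{s' ∼ p(· | s, a)}[max_{a'} q(s', a')]`. -/
structure IsBellmanPair (M : MDP S A) (J : ℝ) (q : S → A → ℝ) : Prop where
  gain : ∀ s, M.optAvgReward s = J
  bellman : ∀ s a, J + q s a = M.r s a + ∑ s', (M.p s a s').toReal * maxValue q s'

/-- The law, after `t` steps started at `s₁`, of the pair consisting of the list of past
state-action pairs `(s_t, a_t), …, (s_1, a_1)` (most recent first) and the current state `s_{t+1}`,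
when actions are chosen by the function `act` of the history: `a_t = act past s_t`. -/
def historyLaw (M : MDP S A) (act : List (S × A) → S → A) (s₁ : S) : ℕ → PMF (List (S × A) × S)
  | 0 => PMF.pure ([], s₁)
  | t + 1 => (M.historyLaw act s₁ t).bind fun h =>
      (M.p h.2 (act h.1 h.2)).map fun s' => ((h.2, act h.1 h.2) :: h.1, s')

/-- The cumulative regret `∑_t (J - r(s_t, a_t))` of a list of state-action pairs. -/
def regret (M : MDP S A) (J : ℝ) (past : List (S × A)) : ℝ :=
  (past.map fun x => J - M.r x.1 x.2).sum

end MDP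

namespace OptimisticQ

variable {S A : Type*} [Fintype S] [Fintype A] [DecidableEq S] [DecidableEq A]

/-- The variables `n_t`, `Q_t`, `Q̂_t`, `V̂_t` held by the algorithm. -/
structure Estimates (S A : Type*) where
  n : S → A → ℕ
  Q : S → A → ℝ
  Qhat : S → A → ℝ
  Vhat : S → ℝ

/-- The initial values. -/
def init (S A : Type*) (H : ℝ) : Estimates S A where
  n := fun _ _ => 0
  Q := fun _ _ => H
  Qhat := fun _ _ => H
  Vhat := fun _ => H

/-- The step size `α_τ = (H + 1) / (H + τ)`. -/
def stepSize (H : ℝ) (τ : ℕ) : ℝ :=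
  (H + 1) / (H + τ)

/-- The bonus `b_τ = 4 sp √((H / τ) ln (2T / δ))`. -/
def bonus (sp H δ : ℝ) (T τ : ℕ) : ℝ :=
  4 * sp * √(H / τ * Real.log (2 * T / δ))

/-- The table `f` with its entry at `(s, a)` replaced by `x`. -/
def setEntry {X : Type*} (f : S → A → X) (s : S) (a : A) (x : X) : S → A → X :=
  Function.update f s (Function.update (f s) a x)

/-- The new value `(1 - α_τ) Q_t(s, a) + α_τ [r(s, a) + γ V̂_t(s') + b_τ]`, with `γ = 1 - 1/H` and
`τ = n_t(s, a) + 1`. -/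
def newQ (r : S → A → ℝ) (sp H δ : ℝ) (T : ℕ) (E : Estimates S A) (s : S) (a : A) (s' : S) : ℝ :=
  (1 - stepSize H (E.n s a + 1)) * E.Q s a +
    stepSize H (E.n s a + 1) *
      (r s a + (1 - 1 / H) * E.Vhat s' + bonus sp H δ T (E.n s a + 1))

/-- The update after playing `a` in state `s` and observing the next state `s'`. -/
def update (r : S → A → ℝ) (sp H δ : ℝ) (T : ℕ) (E : Estimates S A) (s : S) (a : A) (s' : S) :
    Estimates S A :=
  let Qhat' := setEntry E.Qhat s a (min (E.Qhat s a) (newQ r sp H δ T E s a s'))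
  { n := setEntry E.n s a (E.n s a + 1)
    Q := setEntry E.Q s a (newQ r sp H δ T E s a s')
    Qhat := Qhat'
    Vhat := Function.update E.Vhat s (⨆ b, Qhat' s b) }

/-- The estimates held when the past state-action pairs (most recent first) and the current state
are as given. -/
def estimates (r : S → A → ℝ) (sp H δ : ℝ) (T : ℕ) : List (S × A) → S → Estimates S A
  | [], _ => init S A H
  | x :: past, s' => update r sp H δ T (estimates r sp H δ T past x.1) x.1 x.2 s'

/-- `act` plays Optimistic Q-learning: in every history it takes an action maximizing
`Q̂_t(s_t, ·)`, ties being broken arbitrarily as a function of the history. -/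
def IsGreedy (r : S → A → ℝ) (sp H δ : ℝ) (T : ℕ) (act : List (S × A) → S → A) : Prop :=
  ∀ past s a, (estimates r sp H δ T past s).Qhat s a ≤
    (estimates r sp H δ T past s).Qhat s (act past s)

/-- `H = min {√(sp T / (SA)), (T / (SA ln (4T / δ)))^{1/3}}`. -/
def horizon (nS nA : ℕ) (sp δ : ℝ) (T : ℕ) : ℝ :=
  min (√(sp * T / (nS * nA)))
    ((T / (nS * nA * Real.log (4 * T / δ))) ^ (1 / 3 : ℝ))

/-- `√(sp S A T) + sp (T^{2/3} (SA ln (T / δ))^{1/3} + √(T ln (1 / δ)))`. -/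
def rate (nS nA : ℕ) (sp δ : ℝ) (T : ℕ) : ℝ :=
  √(sp * nS * nA * T) +
    sp * ((T : ℝ) ^ (2 / 3 : ℝ) * (nS * nA * Real.log (T / δ)) ^ (1 / 3 : ℝ) +
      √(T * Real.log (1 / δ)))

end OptimisticQ

end

/-! The algorithm learns the optimal value `V` of the problem discounted by γ = 1 - 1/H. Shifted by
constants, v^* becomes a subsolution and a supersolution of the discounted Bellman equation, so `V`
stays within `sp` of `H * J` (`IsDiscountedValue.mem_Icc_of_bellman`). Hence `V` has range at most
`2 * sp`, which fixes the size of the bonuses, and replacing `J` by `V / H` costs only `sp / H` per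
round.

With high probability the bonuses dominate the weighted deviations behind every estimate
(`NoiseBounded`, by Azuma–Hoeffding and a union bound), and then all estimates are upper bounds
(`optimistic_estimates`). The regret is paid for by a potential (`Optimistic.regret_step_le`). Write
q for `actionValue`. As 1 - α_{n+1} = n/(H+n+1), an update changes (H+n)/H * (Q - q) by -(Q - q) +
(1 + 1/H)(γ(V̂(s') - 𝔼V) + b). Here (1 + 1/H)γ = 1 - 1/H² ≤ 1, so the error inherited from s' is not
amplified and cancels against the error at the next step. Summing leaves terms of order SA H, sp √(H
SA T log), T sp/H and one martingale (`regret_le`); the choice of `H` balances them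
(`regret_terms_le_rate`).

A Bellman pair exists by letting the discount vanish: weak communication bounds the span of the
discounted values uniformly (`IsWeaklyCommunicating.exists_span_bound`), so a subsequence of
normalized values converges. -/

section HistoryLaw

open MeasureTheory ProbabilityTheory
open scoped ENNReal

/-! ### Expectations and exponential moments of discrete laws. -/

namespace PMF

variable {α β : Type*}

theorem tsum_bind_mul (p : PMF α) (f : α → PMF β) (F : β → ℝ≥0∞) :
    ∑' b, p.bind f b * F b = ∑' a, p a * ∑' b, f a b * F b := by
  simp only [PMF.bind_apply, ← ENNReal.tsum_mul_right, ← ENNReal.tsum_mul_left]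
  rw [ENNReal.tsum_comm]
  simp only [mul_assoc]

theorem tsum_pure_mul (a : α) (F : α → ℝ≥0∞) : ∑' b, PMF.pure a b * F b = F a := by
  rw [tsum_eq_single a]
  · simp
  · intro b hb
    simp [hb]

theorem tsum_map_mul (p : PMF α) (f : α → β) (F : β → ℝ≥0∞) :
    ∑' b, p.map f b * F b = ∑' a, p a * F (f a) := by
  rw [PMF.map, tsum_bind_mul]
  simp only [Function.comp, tsum_pure_mul]

/-- Markov's inequality. -/
theorem toOuterMeasure_le_tsum_mul (p : PMF α) (F : α → ℝ≥0∞) (s : Set α)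
    (hs : ∀ a ∈ s, 1 ≤ F a) : p.toOuterMeasure s ≤ ∑' a, p a * F a := by
  rw [PMF.toOuterMeasure_apply]
  refine ENNReal.tsum_le_tsum fun a => ?_
  by_cases ha : a ∈ s
  · simpa [ha] using mul_le_mul_right (hs a ha) (p a)
  · simp [ha]

theorem sum_toReal_eq_one [Fintype α] (p : PMF α) : ∑ a, (p a).toReal = 1 := by
  rw [← ENNReal.toReal_sum fun a _ => p.apply_ne_top a, ← tsum_fintype (L := .unconditional α),
    p.tsum_coe, ENNReal.toReal_one]

/-- Hoeffding's lemma for a law on a finite type. -/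
theorem sum_mul_exp_le [Fintype α] (p : PMF α) (V : α → ℝ) {m c : ℝ}
    (hV : ∀ a, V a ∈ Set.Icc m (m + c)) (l : ℝ) :
    ∑ a, (p a).toReal * Real.exp (l * (V a - ∑ b, (p b).toReal * V b)) ≤
      Real.exp (l ^ 2 * c ^ 2 / 8) := by
  let _ : MeasurableSpace α := ⊤
  have h := hasSubgaussianMGF_of_mem_Icc (μ := p.toMeasure) (X := V) (a := m) (b := m + c)
    (measurable_from_top.aemeasurable) (Filter.Eventually.of_forall hV)
  have h2 := h.mgf_le l
  rw [mgf, PMF.integral_eq_sum, PMF.integral_eq_sum] at h2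
  simp only [smul_eq_mul] at h2
  refine h2.trans_eq ?_
  congr 1
  simp only [add_sub_cancel_left, NNReal.coe_pow, NNReal.coe_div, coe_nnnorm, Real.norm_eq_abs,
    NNReal.coe_ofNat, div_pow, sq_abs]
  ring

end PMF

/-! ### Martingale concentration along histories. -/

namespace MDP

variable {S A : Type*}

/-- The expectation of `V` at the state that follows `(s, a)`. -/
noncomputable def nextValue [Fintype S] (M : MDP S A) (V : S → ℝ) (s : S) (a : A) : ℝ :=
  ∑ s', (M.p s a s').toReal * V s'

/-- The sum over a history of the deviations `V(s_{t+1}) - 𝔼[V(s_{t+1}) | s_t, a_t]`, with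
predictable weights `w`. -/
noncomputable def noise [Fintype S] (M : MDP S A) (V : S → ℝ) (w : List (S × A) → S × A → ℝ) :
    List (S × A) → S → ℝ
  | [], _ => 0
  | x :: past, s' => M.noise V w past x.1 + w past x * (V s' - M.nextValue V x.1 x.2)

/-- The sum over a history of the squared weights. -/
def quadVar (w : List (S × A) → S × A → ℝ) : List (S × A) → ℝ
  | [] => 0
  | x :: past => quadVar w past + w past x ^ 2

/-- The actions of the history are those chosen by `act`. -/
def IsPlay (act : List (S × A) → S → A) : List (S × A) → Prop
  | [] => True
  | x :: past => x.2 = act past x.1 ∧ IsPlay act past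

theorem noise_neg [Fintype S] (M : MDP S A) (V : S → ℝ) (w : List (S × A) → S × A → ℝ) (l : List (S × A))
    (s : S) : M.noise V (fun past x => -w past x) l s = -M.noise V w l s := by
  induction l generalizing s with
  | nil => simp [noise]
  | cons x l ih => simp only [noise, ih]; ring

theorem quadVar_neg (w : List (S × A) → S × A → ℝ) (l : List (S × A)) :
    quadVar (fun past x => -w past x) l = quadVar w l := by
  induction l with
  | nil => simp [quadVar]
  | cons x l ih => simp only [quadVar, ih]; ring

theorem quadVar_one (l : List (S × A)) : quadVar (fun _ _ => 1) l = l.length := by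
  induction l with
  | nil => simp [quadVar]
  | cons x l ih => simp [quadVar, ih]

/-- The expectation of a nonnegative supermartingale is at most its initial value. -/
theorem tsum_historyLaw_mul_le (M : MDP S A) (act : List (S × A) → S → A) (s₁ : S)
    (F : List (S × A) → S → ℝ≥0∞)
    (hF : ∀ past s, ∑' s', M.p s (act past s) s' * F ((s, act past s) :: past) s' ≤ F past s)
    (t : ℕ) : ∑' h, M.historyLaw act s₁ t h * F h.1 h.2 ≤ F [] s₁ := by
  induction t with
  | zero => rw [historyLaw, PMF.tsum_pure_mul (([], s₁) : List (S × A) × S) fun h => F h.1 h.2]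
  | succ t ih =>
    rw [historyLaw, PMF.tsum_bind_mul _ _ fun h : List (S × A) × S => F h.1 h.2]
    refine le_trans (ENNReal.tsum_le_tsum fun h => ?_) ih
    rw [PMF.tsum_map_mul _ _ fun h : List (S × A) × S => F h.1 h.2]
    exact mul_le_mul_right (hF h.1 h.2) _

theorem mem_support_historyLaw (M : MDP S A) (act : List (S × A) → S → A) (s₁ : S) (t : ℕ)
    (h : List (S × A) × S) (hh : h ∈ (M.historyLaw act s₁ t).support) :
    h.1.length = t ∧ IsPlay act h.1 := by
  induction t generalizing h with
  | zero =>
    simp only [historyLaw, PMF.support_pure, Set.mem_singleton_iff] at hh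
    simp [hh, IsPlay]
  | succ t ih =>
    simp only [historyLaw, PMF.mem_support_bind_iff, PMF.mem_support_map_iff] at hh
    obtain ⟨g, hg, s', -, rfl⟩ := hh
    obtain ⟨h1, h2⟩ := ih g hg
    simp [h1, IsPlay, h2]

/-- The Azuma–Hoeffding inequality. -/
theorem historyLaw_noise_le [Fintype S] (M : MDP S A) (act : List (S × A) → S → A) (s₁ : S) (t : ℕ)
    (V : S → ℝ) {m c : ℝ} (hc : 0 < c) (hV : ∀ s, V s ∈ Set.Icc m (m + c))
    (w : List (S × A) → S × A → ℝ) {ε B : ℝ} (hB : 0 < B) :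
    (M.historyLaw act s₁ t).toOuterMeasure
        {h | ε ≤ M.noise V w h.1 h.2 ∧ quadVar w h.1 ≤ B ∧ 0 ≤ ε} ≤
      ENNReal.ofReal (Real.exp (-(2 * ε ^ 2 / (c ^ 2 * B)))) := by
  -- This `l` maximizes l ε - l² c² B / 8, the exponent obtained from Markov's inequality.
  set l : ℝ := 4 * ε / (c ^ 2 * B) with hl
  set F : List (S × A) → S → ℝ≥0∞ := fun past s =>
    ENNReal.ofReal (Real.exp (l * M.noise V w past s - l ^ 2 * c ^ 2 / 8 * quadVar w past)) with hF
  have hsup := M.tsum_historyLaw_mul_le act s₁ F (fun past s => ?_) t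
  · have h0 : F [] s₁ = 1 := by simp [hF, noise, quadVar]
    rw [h0] at hsup
    set K : ℝ≥0∞ := ENNReal.ofReal (Real.exp (-(2 * ε ^ 2 / (c ^ 2 * B)))) with hK
    refine (PMF.toOuterMeasure_le_tsum_mul _ (fun h => K * F h.1 h.2) _ ?_).trans ?_
    · rintro h ⟨h1, h2, h3⟩
      rw [hK, hF, ← ENNReal.ofReal_mul (Real.exp_pos _).le, ← Real.exp_add,
        ENNReal.one_le_ofReal, Real.one_le_exp_iff]
      have hl0 : 0 ≤ l := by positivity
      have e1 : l * ε ≤ l * M.noise V w h.1 h.2 := mul_le_mul_of_nonneg_left h1 hl0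
      have e2 : l ^ 2 * c ^ 2 / 8 * quadVar w h.1 ≤ l ^ 2 * c ^ 2 / 8 * B :=
        mul_le_mul_of_nonneg_left h2 (by positivity)
      have e3 : l * ε - l ^ 2 * c ^ 2 / 8 * B = 2 * ε ^ 2 / (c ^ 2 * B) := by
        rw [hl]; field_simp; ring
      linarith
    · calc ∑' h, M.historyLaw act s₁ t h * (K * F h.1 h.2)
          = K * ∑' h, M.historyLaw act s₁ t h * F h.1 h.2 := by
            rw [← ENNReal.tsum_mul_left]; simp only [mul_left_comm]
        _ ≤ K := by simpa using mul_le_mul_right hsup K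
  -- The weight `g` is fixed before the next state is drawn, so Hoeffding's lemma applies; the
  -- increment of `quadVar` cancels its bound.
  · set a := act past s
    set g : ℝ := l * w past (s, a)
    set R : ℝ := l * M.noise V w past s - l ^ 2 * c ^ 2 / 8 * quadVar w past
    have hstep : ∀ s', M.p s a s' * F ((s, a) :: past) s' =
        ENNReal.ofReal (Real.exp (R - g ^ 2 * c ^ 2 / 8) *
          ((M.p s a s').toReal * Real.exp (g * (V s' - ∑ b, (M.p s a b).toReal * V b)))) := by
      intro s'
      conv_lhs => rw [← ENNReal.ofReal_toReal ((M.p s a).apply_ne_top s')]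
      rw [hF, ← ENNReal.ofReal_mul ENNReal.toReal_nonneg, mul_left_comm, ← Real.exp_add]
      simp only [noise, quadVar, nextValue]
      congr 3
      simp only [R, g]
      ring
    rw [tsum_fintype]
    simp only [hstep]
    rw [← ENNReal.ofReal_sum_of_nonneg fun _ _ => by positivity, ← Finset.mul_sum]
    refine ENNReal.ofReal_le_ofReal ?_
    calc _ ≤ Real.exp (R - g ^ 2 * c ^ 2 / 8) * Real.exp (g ^ 2 * c ^ 2 / 8) :=
          mul_le_mul_of_nonneg_left ((M.p s a).sum_mul_exp_le V hV g) (Real.exp_pos _).le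
      _ = Real.exp R := by rw [← Real.exp_add]; congr 1; ring

end MDP

end HistoryLaw

/-! ### The discounted optimality equation and its distance from the average-reward one. -/

theorem le_ciSup_fintype {ι : Type*} [Finite ι] (f : ι → ℝ) (i : ι) : f i ≤ ⨆ j, f j :=
  le_ciSup (Set.finite_range f).bddAbove i

theorem ciInf_le_fintype {ι : Type*} [Finite ι] (f : ι → ℝ) (i : ι) : ⨅ j, f j ≤ f i :=
  ciInf_le (Set.finite_range f).bddBelow i

namespace MDP

variable {S A : Type*} [Fintype S]

theorem nextValue_mono (M : MDP S A) {U V : S → ℝ} (h : ∀ s, U s ≤ V s) (s : S) (a : A) :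
    M.nextValue U s a ≤ M.nextValue V s a :=
  Finset.sum_le_sum fun s' _ => mul_le_mul_of_nonneg_left (h s') ENNReal.toReal_nonneg

theorem nextValue_const (M : MDP S A) (c : ℝ) (s : S) (a : A) :
    M.nextValue (fun _ => c) s a = c := by
  rw [nextValue, ← Finset.sum_mul, PMF.sum_toReal_eq_one, one_mul]

theorem nextValue_add (M : MDP S A) (U V : S → ℝ) (s : S) (a : A) :
    M.nextValue (fun s' => U s' + V s') s a = M.nextValue U s a + M.nextValue V s a := by
  simp only [nextValue, mul_add, Finset.sum_add_distrib]

theorem nextValue_add_const (M : MDP S A) (V : S → ℝ) (c : ℝ) (s : S) (a : A) :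
    M.nextValue (fun s' => V s' + c) s a = M.nextValue V s a + c := by
  rw [nextValue_add, nextValue_const]

/-- `V` solves the Bellman optimality equation with discount factor `γ`. -/
def IsDiscountedValue (M : MDP S A) (γ : ℝ) (V : S → ℝ) : Prop :=
  ∀ s, V s = ⨆ a, (M.r s a + γ * M.nextValue V s a)

variable [Finite A]

theorem exists_isDiscountedValue [Nonempty A] (M : MDP S A) {γ : ℝ} (h0 : 0 ≤ γ) (h1 : γ < 1) :
    ∃ V, M.IsDiscountedValue γ V := by
  let Φ : (S → ℝ) → S → ℝ := fun V s => ⨆ a, (M.r s a + γ * M.nextValue V s a)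
  have key : ∀ U V : S → ℝ, ∀ s, Φ U s ≤ Φ V s + γ * dist U V := by
    intro U V s
    refine ciSup_le fun a => ?_
    have h2 : M.nextValue U s a ≤ M.nextValue V s a + dist U V := by
      rw [← nextValue_add_const]
      refine M.nextValue_mono (fun s' => ?_) s a
      have := (abs_le.1 ((Real.dist_eq _ _).symm.trans_le (dist_le_pi_dist U V s'))).2
      linarith
    have h3 := le_ciSup_fintype (fun a => M.r s a + γ * M.nextValue V s a) a
    have h4 := mul_le_mul_of_nonneg_left h2 h0
    simp only [Φ]
    linarith
  have hΦ : ContractingWith ⟨γ, h0⟩ Φ := by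
    refine ⟨h1, LipschitzWith.of_dist_le_mul fun U V => ?_⟩
    refine (dist_pi_le_iff (mul_nonneg h0 dist_nonneg)).2 fun s => ?_
    rw [Real.dist_eq, abs_le]
    have e1 := key U V s
    have e2 := key V U s
    rw [dist_comm V U] at e2
    change -(γ * dist U V) ≤ Φ U s - Φ V s ∧ Φ U s - Φ V s ≤ γ * dist U V
    constructor <;> linarith
  exact ⟨hΦ.fixedPoint, fun s => (congrFun hΦ.fixedPoint_isFixedPt s).symm⟩

variable {M : MDP S A} {γ : ℝ} {V : S → ℝ}

namespace IsDiscountedValue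

theorem le_value (hV : M.IsDiscountedValue γ V) (s : S) (a : A) :
    M.r s a + γ * M.nextValue V s a ≤ V s :=
  (le_ciSup_fintype (fun a => M.r s a + γ * M.nextValue V s a) a).trans_eq (hV s).symm

theorem exists_eq [Nonempty A] (hV : M.IsDiscountedValue γ V) (s : S) :
    ∃ a, V s = M.r s a + γ * M.nextValue V s a := by
  obtain ⟨a, ha⟩ := exists_eq_ciSup_of_finite (f := fun a => M.r s a + γ * M.nextValue V s a)
  exact ⟨a, (hV s).trans ha.symm⟩

variable [Nonempty S]

/-- Maximum principle: at a maximizer of U - V the gap is at most γ times itself, hence nonpositive.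
-/
theorem ge_of_subsolution (hV : M.IsDiscountedValue γ V) (h0 : 0 ≤ γ) (h1 : γ < 1) {U : S → ℝ}
    (hU : ∀ s, ∃ a, U s ≤ M.r s a + γ * M.nextValue U s a) (s : S) : U s ≤ V s := by
  obtain ⟨s₀, hs₀⟩ := Finite.exists_max fun s => U s - V s
  obtain ⟨a, ha⟩ := hU s₀
  have e1 := hV.le_value s₀ a
  have e2 : M.nextValue U s₀ a ≤ M.nextValue V s₀ a + (U s₀ - V s₀) := by
    rw [← nextValue_add_const]
    exact M.nextValue_mono (fun s' => by linarith [hs₀ s']) s₀ a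
  have e3 := mul_le_mul_of_nonneg_left e2 h0
  have e4 : U s₀ - V s₀ ≤ 0 := by nlinarith
  linarith [hs₀ s]

variable [Nonempty A]

theorem le_of_supersolution (hV : M.IsDiscountedValue γ V) (h0 : 0 ≤ γ) (h1 : γ < 1) {U : S → ℝ}
    (hU : ∀ s a, M.r s a + γ * M.nextValue U s a ≤ U s) (s : S) : V s ≤ U s := by
  obtain ⟨s₀, hs₀⟩ := Finite.exists_max fun s => V s - U s
  obtain ⟨a, ha⟩ := hV.exists_eq s₀
  have e1 := hU s₀ a
  have e2 : M.nextValue V s₀ a ≤ M.nextValue U s₀ a + (V s₀ - U s₀) := by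
    rw [← nextValue_add_const]
    exact M.nextValue_mono (fun s' => by linarith [hs₀ s']) s₀ a
  have e3 := mul_le_mul_of_nonneg_left e2 h0
  have e4 : V s₀ - U s₀ ≤ 0 := by nlinarith
  linarith [hs₀ s]

theorem nonneg (hV : M.IsDiscountedValue γ V) (h0 : 0 ≤ γ) (h1 : γ < 1) (s : S) : 0 ≤ V s := by
  refine hV.ge_of_subsolution (U := fun _ => 0) h0 h1 (fun s => ?_) s
  obtain ⟨a⟩ := ‹Nonempty A›
  exact ⟨a, by simpa [nextValue_const] using (M.r_mem s a).1⟩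

theorem one_sub_mul_le_one (hV : M.IsDiscountedValue γ V) (h0 : 0 ≤ γ) (h1 : γ < 1) (s : S) :
    (1 - γ) * V s ≤ 1 := by
  have h2 : 0 < 1 - γ := by linarith
  have := hV.le_of_supersolution (U := fun _ => 1 / (1 - γ)) h0 h1 (fun s a => ?_) s
  · rwa [le_div_iff₀ h2, mul_comm] at this
  · rw [nextValue_const]
    have e : γ * (1 / (1 - γ)) = 1 / (1 - γ) - 1 := by field_simp; ring
    linarith [(M.r_mem s a).2]

end IsDiscountedValue

/-- The normalized discounted value is within the span of `v^*` of the optimal gain. -/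
theorem IsDiscountedValue.mem_Icc_of_bellman [Nonempty A] [Nonempty S] {H J : ℝ} {q : S → A → ℝ} (hH : 1 < H)
    (hV : M.IsDiscountedValue (1 - 1 / H) V)
    (hq : ∀ s a, J + q s a = M.r s a + M.nextValue (maxValue q) s a) (s : S) :
    V s ∈ Set.Icc (H * J - span (maxValue q)) (H * J + span (maxValue q)) := by
  have hγ0 : 0 ≤ 1 - 1 / H := by
    rw [sub_nonneg, div_le_one (by linarith)]; exact hH.le
  have hγ1 : 1 - 1 / H < 1 := by
    have : 0 < 1 / H := by positivity
    linarith
  have hHH : 1 / H * H = 1 := by field_simp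
  have hpos : 0 < 1 / H := by positivity
  set v := maxValue q with hv
  set γ := 1 - 1 / H
  have hsup := le_ciSup_fintype v
  have hinf := ciInf_le_fintype v
  set hi := ⨆ s, v s
  set lo := ⨅ s, v s
  have hlo : ∀ s a, lo ≤ M.nextValue v s a := fun s a => by
    simpa [nextValue_const] using M.nextValue_mono hinf s a
  have hhi : ∀ s a, M.nextValue v s a ≤ hi := fun s a => by
    simpa [nextValue_const] using M.nextValue_mono hsup s a
  constructor
  -- Discounting subtracts 1/H of the expected next value of `U`, that is `J` plus (𝔼v - hi)/H, and
  -- the latter is nonpositive.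
  · have := hV.ge_of_subsolution (U := fun s => v s + (H * J - hi)) hγ0 hγ1 (fun s => ?_) s
    · simp only [span]
      linarith [hinf s]
    · obtain ⟨a, ha⟩ := exists_eq_ciSup_of_finite (f := q s)
      refine ⟨a, ?_⟩
      have e1 := hq s a
      have e2 : v s = q s a := ha.symm
      rw [nextValue_add_const]
      have e3 := mul_le_mul_of_nonneg_left (hhi s a) hpos.le
      have e4 : γ * (M.nextValue v s a + (H * J - hi)) = M.nextValue v s a + (H * J - hi)
        - 1 / H * M.nextValue v s a - (1 / H * H) * J + 1 / H * hi := by simp only [γ]; ring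
      rw [hHH] at e4
      linarith
  · have := hV.le_of_supersolution (U := fun s => v s + (H * J - lo)) hγ0 hγ1 (fun s a => ?_) s
    · simp only [span]
      linarith [hsup s]
    · have e1 := hq s a
      have e2 : q s a ≤ v s := le_ciSup_fintype (q s) a
      rw [nextValue_add_const]
      have e3 := mul_le_mul_of_nonneg_left (hlo s a) hpos.le
      have e4 : γ * (M.nextValue v s a + (H * J - lo)) = M.nextValue v s a + (H * J - lo)
        - 1 / H * M.nextValue v s a - (1 / H * H) * J + 1 / H * lo := by simp only [γ]; ring
      rw [hHH] at e4
      linarith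

end MDP

theorem sum_sub_sum_of_eq_off {ι : Type*} [Fintype ι] {f g : ι → ℝ} (i : ι)
    (h : ∀ j, j ≠ i → f j = g j) : ∑ j, f j - ∑ j, g j = f i - g i := by
  rw [← Finset.sum_sub_distrib]
  exact Fintype.sum_eq_single i fun j hj => sub_eq_zero.2 (h j hj)

/-! ### Step-size weights and optimism of the estimates. -/

namespace OptimisticQ

open MDP

section Weights

/-- The weights `α_τ^i = α_{i+1} ∏_{j = i+2}^τ (1 - α_j)`, for `i < τ`, of the successive samples in
an estimate that has been updated `τ` times. -/
noncomputable def stepWeight (H : ℝ) : ℕ → ℕ → ℝ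
  | 0, _ => 0
  | τ + 1, i =>
    if i = τ then stepSize H (τ + 1) else (1 - stepSize H (τ + 1)) * stepWeight H τ i

theorem stepWeight_eq_zero (H : ℝ) {τ i : ℕ} (h : τ ≤ i) : stepWeight H τ i = 0 := by
  induction τ with
  | zero => rfl
  | succ τ ih => rw [stepWeight, if_neg (by omega), ih (by omega), mul_zero]

theorem stepWeight_succ_self (H : ℝ) (τ : ℕ) : stepWeight H (τ + 1) τ = stepSize H (τ + 1) := by
  rw [stepWeight, if_pos rfl]

theorem stepWeight_succ_of_lt (H : ℝ) {τ i : ℕ} (h : i < τ) :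
    stepWeight H (τ + 1) i = (1 - stepSize H (τ + 1)) * stepWeight H τ i := by
  rw [stepWeight, if_neg (by omega)]

/-- The noise in an estimate after τ updates thus has variance proxy of order H/τ, the scale of
b_τ². Induction closes because 1 - α_{τ+1} = τ/(H+τ+1). -/
theorem mul_sum_stepWeight_sq_le {H : ℝ} (hH : 1 ≤ H) (τ : ℕ) :
    τ * ∑ i ∈ Finset.range τ, stepWeight H τ i ^ 2 ≤ 2 * H := by
  induction τ with
  | zero => simp; linarith
  | succ τ ih =>
    have h1 : ∑ i ∈ Finset.range τ, stepWeight H (τ + 1) i ^ 2 =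
        (1 - stepSize H (τ + 1)) ^ 2 * ∑ i ∈ Finset.range τ, stepWeight H τ i ^ 2 := by
      rw [Finset.mul_sum]
      refine Finset.sum_congr rfl fun i hi => ?_
      rw [stepWeight_succ_of_lt H (Finset.mem_range.1 hi), mul_pow]
    rw [Finset.sum_range_succ, h1, stepWeight_succ_self, stepSize]
    set X := ∑ i ∈ Finset.range τ, stepWeight H τ i ^ 2
    push_cast
    have ht : (0 : ℝ) ≤ τ := τ.cast_nonneg
    set t : ℝ := (τ : ℝ)
    have hd : 0 < H + (t + 1) := by linarith
    have e1 : 1 - (H + 1) / (H + (t + 1)) = t / (H + (t + 1)) := by field_simp; ring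
    rw [e1, div_pow, div_pow, div_mul_eq_mul_div, ← add_div, mul_div_assoc', div_le_iff₀ (by positivity)]
    have e2 : t ^ 2 * X ≤ t * (2 * H) := by nlinarith
    have e3 : (t + 1) * (t ^ 2 * X + (H + 1) ^ 2) ≤ (t + 1) * (t * (2 * H) + (H + 1) ^ 2) := by
      gcongr
    refine e3.trans ?_
    nlinarith [mul_nonneg ht (sub_nonneg.2 hH), mul_nonneg (sub_nonneg.2 hH) (sq_nonneg (H + 1)),
      mul_nonneg (mul_nonneg ht (sub_nonneg.2 hH)) (by linarith : 0 ≤ H)]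

end Weights

variable {S A : Type*} [DecidableEq S] [DecidableEq A]

theorem setEntry_apply {X : Type*} (f : S → A → X) (s : S) (a : A) (x : X) (s' : S) (a' : A) :
    setEntry f s a x s' a' = if (s', a') = (s, a) then x else f s' a' := by
  by_cases hs : s' = s
  · subst hs
    by_cases ha : a' = a
    · subst ha; simp [setEntry]
    · simp [setEntry, ha]
  · simp [setEntry, hs]

/-- The predictable weight that gives the `i`-th visit (counted from zero) of `x₀` the weight
`f i`, and weight zero to everything else. -/
def visitWeight (f : ℕ → ℝ) (x₀ : S × A) (past : List (S × A)) (x : S × A) : ℝ :=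
  if x = x₀ then f (past.count x₀) else 0

theorem quadVar_visitWeight (f : ℕ → ℝ) (x₀ : S × A) (l : List (S × A)) :
    quadVar (visitWeight f x₀) l = ∑ i ∈ Finset.range (l.count x₀), f i ^ 2 := by
  induction l with
  | nil => simp [quadVar]
  | cons x l ih =>
    by_cases h : x = x₀
    · subst h
      simp [quadVar, visitWeight, ih, Finset.sum_range_succ]
    · simp [quadVar, visitWeight, ih, h, List.count_cons_of_ne h]

theorem mul_quadVar_stepWeight_le {H : ℝ} (hH : 1 ≤ H) (τ : ℕ) (x₀ : S × A) (l : List (S × A)) :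
    τ * quadVar (visitWeight (stepWeight H τ) x₀) l ≤ 2 * H := by
  refine le_trans (mul_le_mul_of_nonneg_left ?_ τ.cast_nonneg) (mul_sum_stepWeight_sq_le hH τ)
  rw [quadVar_visitWeight]
  rcases le_total (l.count x₀) τ with h | h
  · exact Finset.sum_le_sum_of_subset_of_nonneg (Finset.range_mono h) fun _ _ _ => sq_nonneg _
  · refine (Finset.sum_subset (Finset.range_mono h) fun i _ hi => ?_).ge
    rw [stepWeight_eq_zero H (by simpa using hi)]
    ring

variable [Fintype S]

/-- With at most τ visits only the first τ weights are used, and these share the factor 1 - α_{τ+1}.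
-/
theorem noise_stepWeight_succ (M : MDP S A) (V : S → ℝ) (H : ℝ) {τ : ℕ} (x₀ : S × A)
    (l : List (S × A)) (s : S) (h : l.count x₀ ≤ τ) :
    M.noise V (visitWeight (stepWeight H (τ + 1)) x₀) l s =
      (1 - stepSize H (τ + 1)) * M.noise V (visitWeight (stepWeight H τ) x₀) l s := by
  induction l generalizing s with
  | nil => simp [noise]
  | cons x l ih =>
    have hl : l.count x₀ ≤ τ := (List.count_le_count_cons).trans h
    by_cases hx : x = x₀
    · subst hx
      rw [List.count_cons_self] at h
      simp only [noise, ih _ hl, visitWeight, if_true, stepWeight_succ_of_lt H h]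
      ring
    · simp [noise, ih _ hl, visitWeight, hx]

theorem noise_cons_of_ne (M : MDP S A) (V : S → ℝ) (f : ℕ → ℝ) {x x₀ : S × A} (hx : x ≠ x₀)
    (l : List (S × A)) (s : S) :
    M.noise V (visitWeight f x₀) (x :: l) s = M.noise V (visitWeight f x₀) l x.1 := by
  simp [noise, visitWeight, hx]

theorem noise_stepWeight_cons_of_le (M : MDP S A) (V : S → ℝ) (H : ℝ) {τ : ℕ} (x x₀ : S × A)
    (l : List (S × A)) (s : S) (h : τ ≤ l.count x₀) :
    M.noise V (visitWeight (stepWeight H τ) x₀) (x :: l) s =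
      M.noise V (visitWeight (stepWeight H τ) x₀) l x.1 := by
  simp [noise, visitWeight, stepWeight_eq_zero H h]

theorem noise_stepWeight_cons_self (M : MDP S A) (V : S → ℝ) (H : ℝ) (x : S × A)
    (l : List (S × A)) (s : S) :
    M.noise V (visitWeight (stepWeight H (l.count x + 1)) x) (x :: l) s =
      (1 - stepSize H (l.count x + 1)) *
          M.noise V (visitWeight (stepWeight H (l.count x)) x) l x.1 +
        stepSize H (l.count x + 1) * (V s - M.nextValue V x.1 x.2) := by
  rw [noise, noise_stepWeight_succ M V H x l x.1 le_rfl]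
  simp [visitWeight, stepWeight_succ_self]

/-- The optimal discounted action values. -/
noncomputable def actionValue (M : MDP S A) (H : ℝ) (V : S → ℝ) (x : S × A) : ℝ :=
  M.r x.1 x.2 + (1 - 1 / H) * M.nextValue V x.1 x.2

/-- The coefficient of `1 / √τ` in the bonus `b_τ`. -/
noncomputable def bonusCoeff (sp H δ : ℝ) (T : ℕ) : ℝ :=
  4 * sp * √(H * Real.log (2 * T / δ))

theorem bonus_eq {sp H δ : ℝ} {T : ℕ} (hH : 0 ≤ H) (hL : 0 ≤ Real.log (2 * T / δ)) (τ : ℕ) :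
    bonus sp H δ T τ = bonusCoeff sp H δ T / √τ := by
  rw [bonus, bonusCoeff, div_mul_eq_mul_div, Real.sqrt_div (by positivity), ← mul_div_assoc]

/-- In the history `l`, with current state `s`, the deviations in all estimates held so far have been
dominated by the bonuses. -/
def NoiseBounded (M : MDP S A) (V : S → ℝ) (sp H δ : ℝ) (T : ℕ) (l : List (S × A)) (s : S) : Prop :=
  ∀ x₀ : S × A, ∀ τ : ℕ, 0 < τ → τ ≤ l.count x₀ →
    -(bonusCoeff sp H δ T / √τ) ≤ M.noise V (visitWeight (stepWeight H τ) x₀) l s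

/-- After τ visits the weights `stepWeight H τ` vanish and the noise is frozen. The condition at the
final time therefore controls all earlier times, without a union bound over time. -/
theorem NoiseBounded.tail {M : MDP S A} {V : S → ℝ} {sp H δ : ℝ} {T : ℕ} {x : S × A}
    {l : List (S × A)} {s : S} (h : NoiseBounded M V sp H δ T (x :: l) s) :
    NoiseBounded M V sp H δ T l x.1 := by
  intro x₀ τ h0 hτ
  have := h x₀ τ h0 (hτ.trans List.count_le_count_cons)
  rwa [noise_stepWeight_cons_of_le M V H x x₀ l s hτ] at this

/-- The invariants of the algorithm when all deviations are dominated by the bonuses. -/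
structure Optimistic (M : MDP S A) (V : S → ℝ) (sp H δ : ℝ) (T : ℕ) (l : List (S × A)) (s : S)
    (E : Estimates S A) : Prop where
  n_eq : ∀ x : S × A, E.n x.1 x.2 = l.count x
  Qhat_le : ∀ x : S × A, E.Qhat x.1 x.2 ≤ E.Q x.1 x.2
  Vhat_eq : ∀ u, E.Vhat u = ⨆ a, E.Qhat u a
  Vhat_le : ∀ u, E.Vhat u ≤ H
  le_Q : ∀ x : S × A, (1 - 1 / H) * M.noise V (visitWeight (stepWeight H (l.count x)) x) l s +
    bonusCoeff sp H δ T / √(l.count x : ℝ) ≤ E.Q x.1 x.2 - actionValue M H V x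
  le_Qhat : ∀ x : S × A, actionValue M H V x ≤ E.Qhat x.1 x.2
  le_Vhat : ∀ u, V u ≤ E.Vhat u

/-- Bonuses decrease with the visit count, so their weighted average is at least the latest one. -/
theorem Optimistic.cons_Q {M : MDP S A} {V : S → ℝ} {sp H δ : ℝ} {T : ℕ} {x : S × A}
    {l : List (S × A)} {s : S} {E : Estimates S A} (hH : 1 ≤ H) (hsp : 0 ≤ sp)
    (hL : 0 ≤ Real.log (2 * T / δ)) (h : Optimistic M V sp H δ T l x.1 E) :
    (1 - 1 / H) * M.noise V (visitWeight (stepWeight H (l.count x + 1)) x) (x :: l) s +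
      bonusCoeff sp H δ T / √(l.count x + 1 : ℝ) ≤
      newQ M.r sp H δ T E x.1 x.2 s - actionValue M H V x := by
  have hγ : 0 ≤ 1 - 1 / H := by rw [sub_nonneg, div_le_one (by linarith)]; exact hH
  have hB : 0 ≤ bonusCoeff sp H δ T := by unfold bonusCoeff; positivity
  rw [noise_stepWeight_cons_self, newQ, bonus_eq (by linarith) hL, h.n_eq]
  have h1 := h.le_Q x
  have h2 := h.le_Vhat s
  set n := l.count x
  push_cast
  set α := stepSize H (n + 1) with hα
  have hn : (0 : ℝ) ≤ n := n.cast_nonneg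
  have hα0 : 0 ≤ α := by
    rw [hα, stepSize]; push_cast; positivity
  have hα1 : 0 ≤ 1 - α := by
    rw [hα, stepSize, sub_nonneg, div_le_one (by push_cast; linarith)]; push_cast; linarith
  set N := M.noise V (visitWeight (stepWeight H n) x) l x.1
  set B := bonusCoeff sp H δ T
  have h3 : (1 - α) * (B / √(n + 1 : ℝ)) ≤ (1 - α) * (B / √(n : ℝ)) := by
    rcases Nat.eq_zero_or_pos n with h0 | h0
    -- The first step size is 1, so the value `B / √0 = 0` is multiplied by zero.
    · have : α = 1 := by
        rw [hα, stepSize, h0, zero_add, Nat.cast_one]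
        exact div_self (by linarith)
      rw [this]; simp
    · refine mul_le_mul_of_nonneg_left ?_ hα1
      have : (0 : ℝ) < n := by exact_mod_cast h0
      gcongr
      linarith
  have h4 := mul_le_mul_of_nonneg_left h1 hα1
  have h5 := mul_le_mul_of_nonneg_left (mul_le_mul_of_nonneg_left h2 hγ) hα0
  unfold actionValue at h4 ⊢
  linarith

variable [Fintype A] [Nonempty A]

theorem optimistic_estimates {M : MDP S A} {V : S → ℝ} {sp H δ : ℝ} {T : ℕ} (hH : 1 ≤ H)
    (hsp : 0 ≤ sp) (hL : 0 ≤ Real.log (2 * T / δ)) (hV : M.IsDiscountedValue (1 - 1 / H) V)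
    (hVH : ∀ s, V s ≤ H) (l : List (S × A)) (s : S) (hl : NoiseBounded M V sp H δ T l s) :
    Optimistic M V sp H δ T l s (estimates M.r sp H δ T l s) := by
  have hγ : 0 ≤ 1 - 1 / H := by rw [sub_nonneg, div_le_one (by linarith)]; exact hH
  have hγ1 : 1 - 1 / H ≤ 1 := by
    have : 0 < 1 / H := by positivity
    linarith
  have hB : 0 ≤ bonusCoeff sp H δ T := by unfold bonusCoeff; positivity
  induction l generalizing s with
  | nil =>
    have hQ : ∀ x, actionValue M H V x ≤ H := fun x => (hV.le_value x.1 x.2).trans (hVH _)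
    -- Before any visit the noise and `bonusCoeff / √0` are both 0, so only q ≤ H is needed.
    exact ⟨fun x => rfl, fun x => le_rfl, fun u => (ciSup_const).symm, fun u => le_rfl,
      fun x => by simpa [noise, estimates, init] using hQ x, hQ, hVH⟩
  | cons x l ih =>
    have h := ih x.1 hl.tail
    have hnew := h.cons_Q (s := s) hH hsp hL
    rw [estimates]
    set E := estimates M.r sp H δ T l x.1
    have hQhat : ∀ y : S × A, (update M.r sp H δ T E x.1 x.2 s).Qhat y.1 y.2 =
        if y = x then min (E.Qhat x.1 x.2) (newQ M.r sp H δ T E x.1 x.2 s)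
        else E.Qhat y.1 y.2 := fun y => setEntry_apply _ _ _ _ _ _
    have hQ : ∀ y : S × A, (update M.r sp H δ T E x.1 x.2 s).Q y.1 y.2 =
        if y = x then newQ M.r sp H δ T E x.1 x.2 s else E.Q y.1 y.2 :=
      fun y => setEntry_apply _ _ _ _ _ _
    have hn : ∀ y : S × A, (update M.r sp H δ T E x.1 x.2 s).n y.1 y.2 =
        if y = x then E.n x.1 x.2 + 1 else E.n y.1 y.2 := fun y => setEntry_apply _ _ _ _ _ _
    have hVeq : ∀ u, (update M.r sp H δ T E x.1 x.2 s).Vhat u =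
        ⨆ a, (update M.r sp H δ T E x.1 x.2 s).Qhat u a := by
      intro u
      by_cases hu : u = x.1
      · subst hu; simp [update]
      · have : ∀ a, (update M.r sp H δ T E x.1 x.2 s).Qhat u a = E.Qhat u a := fun a => by
          rw [hQhat (u, a), if_neg]
          rintro rfl
          exact hu rfl
        simp only [this, ← h.Vhat_eq u]
        simp [update, hu]
    have hQmono : ∀ y : S × A,
        (update M.r sp H δ T E x.1 x.2 s).Qhat y.1 y.2 ≤ E.Qhat y.1 y.2 := by
      intro y
      rw [hQhat]
      split_ifs with hy
      · subst hy; exact min_le_left _ _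
      · exact le_rfl
    have hcount : ∀ y, y ≠ x → (x :: l).count y = l.count y := fun y hy =>
      List.count_cons_of_ne hy.symm
    have hQle : ∀ y : S × A, actionValue M H V y ≤
        (update M.r sp H δ T E x.1 x.2 s).Qhat y.1 y.2 := by
      intro y
      rw [hQhat]
      split_ifs with hy
      · subst hy
        refine le_min (h.le_Qhat y) ?_
        -- The deviation in the estimate just formed; since γ ≤ 1, the accumulated bonus outweighs
        -- it.
        have h1 := hl y (l.count y + 1) (by omega) (by rw [List.count_cons_self])
        have h2 := mul_le_mul_of_nonneg_left h1 hγ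
        push_cast at h2
        have h3 : (1 - 1 / H) * (bonusCoeff sp H δ T / √(l.count y + 1 : ℝ)) ≤
            bonusCoeff sp H δ T / √(l.count y + 1 : ℝ) :=
          mul_le_of_le_one_left (by positivity) hγ1
        linarith
      · exact h.le_Qhat y
    refine ⟨fun y => ?_, fun y => ?_, hVeq, fun u => ?_, fun y => ?_, hQle, fun u => ?_⟩
    · rw [hn]
      split_ifs with hy
      · rw [hy, List.count_cons_self, h.n_eq]
      · rw [hcount y hy, h.n_eq]
    · rw [hQhat, hQ]
      split_ifs with hy
      · exact min_le_right _ _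
      · exact h.Qhat_le y
    · rw [hVeq]
      refine ciSup_le fun a => (hQmono (u, a)).trans (le_trans ?_ (h.Vhat_le u))
      rw [h.Vhat_eq]
      exact le_ciSup_fintype (fun a => E.Qhat u a) a
    · rw [hQ]
      split_ifs with hy
      · subst hy
        rw [List.count_cons_self]
        push_cast
        exact hnew
      · rw [hcount y hy, noise_cons_of_ne M V _ (Ne.symm hy)]
        exact h.le_Q y
    · rw [hVeq, hV u]
      refine ciSup_mono (Set.finite_range _).bddAbove fun a => hQle (u, a)

end OptimisticQ

/-! ### The potential argument for the regret. -/

namespace OptimisticQ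

open MDP

variable {S A : Type*} [DecidableEq S] [DecidableEq A] [Fintype S]

/-- The contribution of a state-action pair to the potential. -/
noncomputable def pairPotential (M : MDP S A) (V : S → ℝ) (sp H δ : ℝ) (T : ℕ) (E : Estimates S A)
    (x : S × A) : ℝ :=
  (H + E.n x.1 x.2) / H * (E.Q x.1 x.2 - actionValue M H V x) -
    (1 + 1 / H) * (2 * bonusCoeff sp H δ T * √(E.n x.1 x.2 : ℝ))

variable [Fintype A]

/-- The potential of the estimates `E` held in state `s`. -/
noncomputable def potential (M : MDP S A) (V : S → ℝ) (sp H δ : ℝ) (T : ℕ) (E : Estimates S A)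
    (s : S) : ℝ :=
  ∑ x, pairPotential M V sp H δ T E x + ∑ u, E.Vhat u - (E.Vhat s - V s) - (1 - 1 / H) * V s

/-- Concavity of the square root; it lets the √n term of the potential absorb each bonus. -/
theorem inv_sqrt_succ_le (n : ℕ) : 1 / √(n + 1 : ℝ) ≤ 2 * (√(n + 1 : ℝ) - √n) := by
  have hn : (0 : ℝ) ≤ n := n.cast_nonneg
  have h1 : 0 < √(n + 1 : ℝ) := Real.sqrt_pos.2 (by linarith)
  have h2 := Real.sq_sqrt hn
  have h3 := Real.sq_sqrt (by linarith : (0 : ℝ) ≤ n + 1)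
  rw [div_le_iff₀ h1]
  nlinarith [sq_nonneg (√(n + 1 : ℝ) - √n)]

variable {M : MDP S A} {V : S → ℝ} {sp H δ J : ℝ} {T : ℕ}

/-- The regret of a step is paid for by the decrease of the potential. -/
theorem Optimistic.regret_step_le {l : List (S × A)} {x : S × A} {s : S} {E : Estimates S A}
    (hH : 1 ≤ H) (hsp : 0 ≤ sp) (hL : 0 ≤ Real.log (2 * T / δ))
    (h : Optimistic M V sp H δ T l x.1 E)
    (h' : Optimistic M V sp H δ T (x :: l) s (update M.r sp H δ T E x.1 x.2 s))
    (hJ : J ≤ 1 / H * V x.1 + sp / H) (hx : ∀ a, E.Qhat x.1 a ≤ E.Qhat x.1 x.2) :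
    J - M.r x.1 x.2 ≤ potential M V sp H δ T E x.1 -
      potential M V sp H δ T (update M.r sp H δ T E x.1 x.2 s) s + sp / H +
      (1 / H - 1 / H ^ 2) * (V s - M.nextValue V x.1 x.2) := by
  have hB : 0 ≤ bonusCoeff sp H δ T := by unfold bonusCoeff; positivity
  have hH0 : 0 < H := by linarith
  set E' := update M.r sp H δ T E x.1 x.2 s with hE'
  have hoff : ∀ y : S × A, y ≠ x →
      pairPotential M V sp H δ T E' y = pairPotential M V sp H δ T E y := by
    intro y hy
    have e1 : E'.n y.1 y.2 = E.n y.1 y.2 :=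
      (setEntry_apply _ _ _ _ _ _).trans (if_neg hy)
    have e2 : E'.Q y.1 y.2 = E.Q y.1 y.2 :=
      (setEntry_apply _ _ _ _ _ _).trans (if_neg hy)
    rw [pairPotential, pairPotential, e1, e2]
  have hsum := sum_sub_sum_of_eq_off x hoff
  have hVdec : ∀ u, E'.Vhat u ≤ E.Vhat u := by
    intro u
    have : Nonempty A := ⟨x.2⟩
    rw [h.Vhat_eq, h'.Vhat_eq]
    refine ciSup_mono (Set.finite_range _).bddAbove fun a => ?_
    refine (setEntry_apply _ _ _ _ _ _).trans_le ?_
    split_ifs with hy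
    · rw [Prod.mk.injEq] at hy
      rw [hy.1, hy.2]
      exact min_le_left _ _
    · exact le_rfl
  -- The update uses the old V̂ at the next state, the next step the new one. Their difference is
  -- paid by the nonincreasing sum of V̂ over all states.
  have hVsum : E.Vhat s - E'.Vhat s ≤ ∑ u, E.Vhat u - ∑ u, E'.Vhat u := by
    rw [← Finset.sum_sub_distrib]
    exact Finset.single_le_sum (f := fun u => E.Vhat u - E'.Vhat u)
      (fun u _ => sub_nonneg.2 (hVdec u)) (Finset.mem_univ s)
  have hVx : E.Vhat x.1 ≤ E.Q x.1 x.2 := by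
    have : Nonempty A := ⟨x.2⟩
    rw [h.Vhat_eq]
    exact ciSup_le fun a => (hx a).trans (h.Qhat_le x)
  have e1 : E'.n x.1 x.2 = E.n x.1 x.2 + 1 :=
    (setEntry_apply _ _ _ _ _ _).trans (if_pos rfl)
  have e2 : E'.Q x.1 x.2 = newQ M.r sp H δ T E x.1 x.2 s :=
    (setEntry_apply _ _ _ _ _ _).trans (if_pos rfl)
  -- The factor (H+n+1)/H turns α_{n+1} into 1 + 1/H and 1 - α_{n+1} into n/H, which is one less
  -- than the old factor (H+n)/H.
  have hpair : pairPotential M V sp H δ T E' x - pairPotential M V sp H δ T E x =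
      -(E.Q x.1 x.2 - actionValue M H V x) +
      (1 - 1 / H ^ 2) * (E.Vhat s - M.nextValue V x.1 x.2) +
      (1 + 1 / H) * bonusCoeff sp H δ T * (1 / √(E.n x.1 x.2 + 1 : ℝ) -
        2 * (√(E.n x.1 x.2 + 1 : ℝ) - √(E.n x.1 x.2 : ℝ))) := by
    rw [pairPotential, pairPotential, e1, e2, newQ, bonus_eq hH0.le hL, stepSize, actionValue]
    push_cast
    have hn : (0 : ℝ) ≤ E.n x.1 x.2 := Nat.cast_nonneg _
    have h1 : √(E.n x.1 x.2 + 1 : ℝ) ≠ 0 := (Real.sqrt_pos.2 (by linarith)).ne'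
    have h2 : H + ((E.n x.1 x.2 : ℝ) + 1) ≠ 0 := by linarith
    field_simp
    ring
  have hbonus : (1 + 1 / H) * bonusCoeff sp H δ T * (1 / √(E.n x.1 x.2 + 1 : ℝ) -
        2 * (√(E.n x.1 x.2 + 1 : ℝ) - √(E.n x.1 x.2 : ℝ))) ≤ 0 :=
    mul_nonpos_of_nonneg_of_nonpos (by positivity) (sub_nonpos.2 (inv_sqrt_succ_le _))
  have hg : (1 - 1 / H ^ 2) * (E.Vhat s - V s) ≤ E.Vhat s - V s :=
    mul_le_of_le_one_left (sub_nonneg.2 (h.le_Vhat s)) (by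
      have : 0 < 1 / H ^ 2 := by positivity
      linarith)
  unfold potential
  unfold actionValue at hpair
  -- The noise coefficient 1/H - 1/H² is 1 - 1/H² from the update minus γ from telescoping γ V(s_t).
  linear_combination hVsum + hVx + hbonus + hg + hJ + hsum + hpair

/-- Cauchy–Schwarz: the counts sum to the length of the history. -/
theorem sum_sqrt_count_le (l : List (S × A)) :
    ∑ x : S × A, √(l.count x : ℝ) ≤ √(Fintype.card S * Fintype.card A * l.length) := by
  refine Real.le_sqrt_of_sq_le ?_
  have h := sq_sum_le_card_mul_sum_sq (s := (Finset.univ : Finset (S × A)))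
    (f := fun x => √(l.count x : ℝ))
  refine h.trans_eq ?_
  have hc : ∑ x : S × A, l.count x = l.length := by
    clear h
    induction l with
    | nil => simp
    | cons y l ih => simp [List.count_cons, Finset.sum_add_distrib, ih]
  simp only [Real.sq_sqrt (Nat.cast_nonneg _), Finset.card_univ, Fintype.card_prod]
  rw [← Nat.cast_sum, hc]
  push_cast
  rfl

variable [Nonempty A]

/-- The existential state is where the history started, which the induction meets only at the end of
the list; the bound on the initial potential is uniform in it. -/
theorem regret_le_potential (hH : 1 ≤ H)
    (hsp : 0 ≤ sp) (hL : 0 ≤ Real.log (2 * T / δ)) (hV : M.IsDiscountedValue (1 - 1 / H) V)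
    (hVH : ∀ s, V s ≤ H) (hJ : ∀ s, J ≤ 1 / H * V s + sp / H) {act : List (S × A) → S → A}
    (hact : IsGreedy M.r sp H δ T act) (l : List (S × A)) (s : S) (hplay : IsPlay act l)
    (hl : NoiseBounded M V sp H δ T l s) :
    ∃ s₁, M.regret J l ≤ potential M V sp H δ T (init S A H) s₁ -
      potential M V sp H δ T (estimates M.r sp H δ T l s) s + l.length * (sp / H) +
      (1 / H - 1 / H ^ 2) * M.noise V (fun _ _ => 1) l s := by
  induction l generalizing s with
  | nil => exact ⟨s, by simp [regret, noise, estimates]⟩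
  | cons x l ih =>
    obtain ⟨s₁, h1⟩ := ih x.1 hplay.2 hl.tail
    refine ⟨s₁, ?_⟩
    have h := optimistic_estimates hH hsp hL hV hVH l x.1 hl.tail
    have h' := optimistic_estimates hH hsp hL hV hVH (x :: l) s hl
    have h2 := h.regret_step_le hH hsp hL h' (hJ x.1) (fun a => by
      rw [hplay.1]; exact hact l x.1 a)
    rw [estimates]
    simp only [regret, List.map_cons, List.sum_cons, noise, List.length_cons] at h1 ⊢
    push_cast
    linarith

/-- The regret of a history in which all deviations are dominated by the bonuses. -/
theorem regret_le (hH : 1 ≤ H)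
    (hsp : 0 ≤ sp) (hL : 0 ≤ Real.log (2 * T / δ)) (hV : M.IsDiscountedValue (1 - 1 / H) V)
    (hV0 : ∀ s, 0 ≤ V s)
    (hVH : ∀ s, V s ≤ H) (hJ : ∀ s, J ≤ 1 / H * V s + sp / H) {act : List (S × A) → S → A}
    (hact : IsGreedy M.r sp H δ T act) (l : List (S × A)) (s : S) (hplay : IsPlay act l)
    (hl : NoiseBounded M V sp H δ T l s) :
    M.regret J l ≤ 4 * (Fintype.card S * Fintype.card A * H) +
      4 * bonusCoeff sp H δ T * √(Fintype.card S * Fintype.card A * l.length) +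
      l.length * (sp / H) + (1 / H - 1 / H ^ 2) * M.noise V (fun _ _ => 1) l s := by
  obtain ⟨s₁, h1⟩ := regret_le_potential hH hsp hL hV hVH hJ hact l s hplay hl
  refine h1.trans ?_
  have hB : 0 ≤ bonusCoeff sp H δ T := by unfold bonusCoeff; positivity
  have hH0 : 0 < H := by linarith
  have hH1 : 1 / H ≤ 1 := by rw [div_le_one hH0]; exact hH
  have hγ : 0 ≤ 1 - 1 / H := by linarith
  have hpos : 0 < 1 / H := by positivity
  have hQ0 : ∀ x : S × A, 0 ≤ actionValue M H V x := fun x => by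
    have h3 := M.nextValue_mono hV0 x.1 x.2
    rw [nextValue_const] at h3
    have := (M.r_mem x.1 x.2).1
    unfold actionValue
    positivity
  have hinit : potential M V sp H δ T (init S A H) s₁ ≤
      Fintype.card S * Fintype.card A * H + Fintype.card S * H := by
    have e1 : ∑ x : S × A, pairPotential M V sp H δ T (init S A H) x ≤ ∑ _x : S × A, H := by
      refine Finset.sum_le_sum fun x _ => ?_
      simp only [pairPotential, init, Nat.cast_zero, add_zero, div_self hH0.ne', Real.sqrt_zero]
      linarith [hQ0 x]
    simp only [Finset.sum_const, Finset.card_univ, Fintype.card_prod, nsmul_eq_mul,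
      Nat.cast_mul] at e1
    have e2 := mul_nonneg hγ (hV0 s₁)
    have e3 := hVH s₁
    simp only [potential, init, Finset.sum_const, Finset.card_univ, nsmul_eq_mul]
    simp only [init] at e1
    linarith
  have h := optimistic_estimates hH hsp hL hV hVH l s hl
  have hfin : -(4 * bonusCoeff sp H δ T * √(Fintype.card S * Fintype.card A * l.length)) - 2 * H ≤
      potential M V sp H δ T (estimates M.r sp H δ T l s) s := by
    set E := estimates M.r sp H δ T l s
    have e1 : ∑ x : S × A, -(4 * bonusCoeff sp H δ T * √(l.count x : ℝ)) ≤
        ∑ x : S × A, pairPotential M V sp H δ T E x := by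
      refine Finset.sum_le_sum fun x _ => ?_
      have f1 : 0 ≤ (H + E.n x.1 x.2) / H * (E.Q x.1 x.2 - actionValue M H V x) :=
        mul_nonneg (by positivity) (sub_nonneg.2 ((h.le_Qhat x).trans (h.Qhat_le x)))
      have f2 : (1 + 1 / H) * (2 * bonusCoeff sp H δ T * √(l.count x : ℝ)) ≤
          2 * (2 * bonusCoeff sp H δ T * √(l.count x : ℝ)) :=
        mul_le_mul_of_nonneg_right (by linarith) (by positivity)
      rw [← h.n_eq] at f2 ⊢
      unfold pairPotential
      linarith
    rw [Finset.sum_neg_distrib, ← Finset.mul_sum] at e1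
    have e2 := mul_le_mul_of_nonneg_left (sum_sqrt_count_le l)
      (by positivity : 0 ≤ 4 * bonusCoeff sp H δ T)
    have e3 : 0 ≤ ∑ u, E.Vhat u := Finset.sum_nonneg fun u _ => (hV0 u).trans (h.le_Vhat u)
    have e4 := h.Vhat_le s
    have e5 : (1 - 1 / H) * V s ≤ V s := mul_le_of_le_one_left (hV0 s) (by linarith)
    have e6 := hVH s
    have e7 := hV0 s
    unfold potential
    linarith
  have hS : (1 : ℝ) ≤ Fintype.card S := by
    exact_mod_cast Fintype.card_pos_iff.2 ⟨s⟩
  have hA : (1 : ℝ) ≤ Fintype.card A := by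
    exact_mod_cast Fintype.card_pos
  have c1 : Fintype.card S * H ≤ Fintype.card S * Fintype.card A * H := by
    refine mul_le_mul_of_nonneg_right ?_ hH0.le
    exact le_mul_of_one_le_right (by linarith) hA
  have c2 : H ≤ Fintype.card S * H := le_mul_of_one_le_left hH0.le hS
  linarith

end OptimisticQ

/-! ### Size of the regret terms and probability of the good event. -/

section RegretBound

open scoped ENNReal

namespace OptimisticQ

open MDP

section Rate

variable {nS nA T : ℕ} {sp δ : ℝ}

theorem rpow_third_pow {x : ℝ} (hx : 0 ≤ x) : (x ^ (1 / 3 : ℝ)) ^ 3 = x := by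
  rw [← Real.rpow_natCast, ← Real.rpow_mul hx]
  norm_num

theorem sqrt_half_mul_log_le {t : ℝ} (ht : 0 ≤ t) (hδ0 : 0 < δ) (hδ1 : δ < 1) :
    √(t / 2 * Real.log (2 / δ)) ≤ √t + √(t * Real.log (1 / δ)) := by
  have hlδ : 0 ≤ Real.log (1 / δ) := Real.log_nonneg (by rw [le_div_iff₀ hδ0]; linarith)
  rw [Real.sqrt_le_left (by positivity), add_sq, Real.sq_sqrt ht,
    Real.sq_sqrt (by positivity)]
  have e2 : Real.log (2 / δ) = Real.log 2 + Real.log (1 / δ) := by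
    rw [← Real.log_mul (by norm_num) (by positivity)]; congr 1; ring
  have e3 : Real.log 2 ≤ 1 := by linarith [Real.log_two_lt_d9]
  have e4 : 0 ≤ 2 * √t * √(t * Real.log (1 / δ)) := by positivity
  rw [e2]
  nlinarith [mul_le_mul_of_nonneg_left e3 ht, mul_nonneg ht hlδ]

/-- If the horizon is at least `2` then the number of rounds is large. -/
theorem large_of_two_le_horizon (hS : 1 ≤ nS) (hA : 1 ≤ nA) (hδ0 : 0 < δ) (hδ1 : δ < 1)
    (h : 2 ≤ horizon nS nA sp δ T) :
    0 < sp ∧ 1 ≤ Real.log (4 * T / δ) ∧ 8 * (nS * nA * Real.log (4 * T / δ)) ≤ T := by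
  obtain ⟨h1, h2⟩ := le_min_iff.1 h
  have hN : (1 : ℝ) ≤ nS * nA := by exact_mod_cast Nat.one_le_iff_ne_zero.2 (by positivity)
  have hT : 0 < T := by
    rcases Nat.eq_zero_or_pos T with rfl | h0
    · norm_num at h1
    · exact h0
  have hT1 : (1 : ℝ) ≤ T := by exact_mod_cast hT
  have hsp : 0 < sp := by
    by_contra hneg
    -- The square root of a nonpositive number is 0, so a horizon of at least 2 forces `sp > 0`.
    rw [Real.sqrt_eq_zero_of_nonpos] at h1
    · norm_num at h1
    · refine div_nonpos_of_nonpos_of_nonneg (mul_nonpos_of_nonpos_of_nonneg (not_lt.1 hneg) ?_) ?_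
        <;> linarith
  have hL : 1 ≤ Real.log (4 * T / δ) := by
    rw [Real.le_log_iff_exp_le (by positivity), le_div_iff₀ hδ0]
    have := Real.exp_one_lt_d9
    nlinarith [Real.exp_pos 1]
  refine ⟨hsp, hL, ?_⟩
  have h3 : (2 : ℝ) ^ 3 ≤ ((T / (nS * nA * Real.log (4 * T / δ))) ^ (1 / 3 : ℝ)) ^ 3 :=
    pow_le_pow_left₀ (by norm_num) h2 3
  rw [rpow_third_pow (by positivity)] at h3
  norm_num at h3
  rwa [le_div_iff₀ (by positivity)] at h3

set_option maxHeartbeats 600000 in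
/-- All terms of the regret bound are of the order of the rate. -/
theorem regret_terms_le_rate {H ε : ℝ} (hS : 1 ≤ nS) (hA : 1 ≤ nA) (hδ0 : 0 < δ) (hδ1 : δ < 1)
    (hH : H = horizon nS nA sp δ T) (h2 : 2 ≤ H)
    (hε : ε ≤ 2 * sp * √(T / 2 * Real.log (2 / δ))) :
    4 * (nS * nA * H) + 4 * bonusCoeff sp H δ T * √(nS * nA * T) + T * (sp / H) +
      (1 / H - 1 / H ^ 2) * ε ≤ 36 * rate nS nA sp δ T := by
  obtain ⟨hsp, hL, hT⟩ := large_of_two_le_horizon hS hA hδ0 hδ1 (hH ▸ h2)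
  have hN : (1 : ℝ) ≤ nS * nA := by exact_mod_cast Nat.one_le_iff_ne_zero.2 (by positivity)
  have hab : H = min (√(sp * T / (nS * nA)))
    ((T / (nS * nA * Real.log (4 * T / δ))) ^ (1 / 3 : ℝ)) := hH
  have hz : ((T : ℝ) ^ (2 / 3 : ℝ) * (nS * nA * Real.log (T / δ)) ^ (1 / 3 : ℝ)) =
      ((T : ℝ) ^ 2 * (nS * nA * Real.log (T / δ))) ^ (1 / 3 : ℝ) := by
    have hT8 : (1 : ℝ) ≤ T := by nlinarith
    have hl : 0 ≤ Real.log (T / δ) := Real.log_nonneg (by rw [le_div_iff₀ hδ0]; linarith)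
    rw [Real.mul_rpow (x := (T : ℝ) ^ 2) (by positivity) (by positivity),
      ← Real.rpow_natCast (T : ℝ) 2,
      ← Real.rpow_mul (by positivity)]
    norm_num
  rw [rate, hz, mul_assoc sp (nS : ℝ) (nA : ℝ)]
  set N : ℝ := nS * nA
  set L := Real.log (4 * T / δ) with hLdef
  set a := √(sp * T / N) with ha
  set b := (T / (N * L)) ^ (1 / 3 : ℝ) with hb
  set z := ((T : ℝ) ^ 2 * (N * Real.log (T / δ))) ^ (1 / 3 : ℝ) with hzdef
  have hNL : 1 ≤ N * L := one_le_mul_of_one_le_of_one_le hN hL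
  have hT8 : (8 : ℝ) ≤ T := by linarith
  have hHa : H ≤ a := hab.trans_le (min_le_left _ _)
  have hHb : H ≤ b := hab.trans_le (min_le_right _ _)
  have hH0 : 0 < H := by linarith
  have ha0 : 0 < a := by linarith
  have hb0 : 0 < b := by linarith
  have hb3 : b ^ 3 = T / (N * L) := rpow_third_pow (by positivity)
  have hTδ : 4 ≤ T / δ := by rw [le_div_iff₀ hδ0]; nlinarith
  have hl1 : 1 ≤ Real.log (T / δ) := by
    rw [Real.le_log_iff_exp_le (by positivity)]
    linarith [Real.exp_one_lt_d9]
  have hL2 : L ≤ 2 * Real.log (T / δ) := by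
    rw [hLdef, mul_div_assoc, Real.log_mul (by norm_num) (by positivity), two_mul]
    gcongr
  set l := Real.log (T / δ)
  have hz0 : 0 ≤ z := by positivity
  have hz3 : z ^ 3 = T ^ 2 * (N * l) := rpow_third_pow (by positivity)
  -- The cube of T/b is T² N L, at most 2 z³ because L ≤ 2 l.
  have hTb : T / b ≤ 2 * z := by
    refine le_of_pow_le_pow_left₀ (n := 3) (by norm_num) (by positivity) ?_
    rw [div_pow, hb3, mul_pow, hz3]
    have e : (T : ℝ) ^ 3 / (T / (N * L)) = T ^ 2 * (N * L) := by field_simp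
    rw [e]
    nlinarith [mul_le_mul_of_nonneg_left hL2 (by positivity : 0 ≤ (T : ℝ) ^ 2 * N),
      (by positivity : 0 ≤ (T : ℝ) ^ 2 * N * l)]
  have hTz : √(T : ℝ) ≤ z := by
    refine le_of_pow_le_pow_left₀ (n := 3) (by norm_num) hz0 ?_
    have e1 : √(T : ℝ) ^ 2 = T := Real.sq_sqrt (by positivity)
    have e2 : √(T : ℝ) ≤ T := by
      rw [Real.sqrt_le_left (by positivity)]; nlinarith
    have e3 : 1 ≤ N * l := one_le_mul_of_one_le_of_one_le hN hl1
    rw [hz3, pow_succ, e1]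
    nlinarith
  have ha2 : a ^ 2 = sp * T / N := Real.sq_sqrt (by positivity)
  set R := √(sp * N * T) with hR
  have hR0 : 0 ≤ R := Real.sqrt_nonneg _
  have t1 : N * H ≤ R := by
    refine (mul_le_mul_of_nonneg_left hHa (by positivity)).trans (Real.le_sqrt_of_sq_le ?_)
    rw [mul_pow, ha2]
    apply le_of_eq
    field_simp
  -- If `H = a` the left side equals `R`; if `H = b` it is `sp * (T / b)`.
  have t2 : T * (sp / H) ≤ R + sp * (2 * z) := by
    rcases min_choice a b with hm | hm
    · rw [hm] at hab
      have : T * (sp / H) ≤ R := by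
        rw [hab]
        refine Real.le_sqrt_of_sq_le ?_
        rw [mul_pow, div_pow, ha2]
        apply le_of_eq
        field_simp
      have : 0 ≤ sp * (2 * z) := by positivity
      linarith
    · rw [hm] at hab
      have : T * (sp / H) = sp * (T / b) := by rw [hab]; ring
      have := mul_le_mul_of_nonneg_left hTb hsp.le
      linarith
  have t3 : bonusCoeff sp H δ T * √(N * T) ≤ 8 * (sp * z) := by
    have hL'0 : 0 ≤ Real.log (2 * T / δ) :=
      Real.log_nonneg (by rw [le_div_iff₀ hδ0]; linarith)
    have hL' : Real.log (2 * T / δ) ≤ L := by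
      refine Real.log_le_log (by positivity) ?_
      gcongr
      norm_num
    -- From `H ≤ b` and b³ = T/(N L): the product b L N T equals (T/b)².
    have e1 : √(H * Real.log (2 * T / δ)) * √(N * T) ≤ T / b := by
      rw [← Real.sqrt_mul (by positivity), Real.sqrt_le_left (by positivity), div_pow]
      have e2 : H * Real.log (2 * T / δ) * (N * T) ≤ b * L * (N * T) := by gcongr
      refine e2.trans_eq ?_
      rw [eq_div_iff (by positivity)]
      calc b * L * (N * T) * b ^ 2 = b ^ 3 * (L * N * T) := by ring
        _ = (T : ℝ) ^ 2 := by rw [hb3]; field_simp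
    have e3 := mul_le_mul_of_nonneg_left (e1.trans hTb) (by positivity : 0 ≤ 4 * sp)
    unfold bonusCoeff
    linarith
  have t4 : (1 / H - 1 / H ^ 2) * ε ≤ 2 * sp * (z + √(T * Real.log (1 / δ))) := by
    have hH1 : 1 / H ≤ 1 := by rw [div_le_one hH0]; linarith
    have hH2 : 0 < 1 / H ^ 2 := by positivity
    have hH3 : 0 ≤ 1 / H - 1 / H ^ 2 := by
      rw [sub_nonneg]
      exact one_div_le_one_div_of_le hH0 (by nlinarith)
    have e1 : √(T / 2 * Real.log (2 / δ)) ≤ z + √(T * Real.log (1 / δ)) :=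
      (sqrt_half_mul_log_le (by positivity) hδ0 hδ1).trans (by gcongr)
    have e5 := mul_le_mul_of_nonneg_left e1 (by positivity : 0 ≤ 2 * sp)
    calc (1 / H - 1 / H ^ 2) * ε
        ≤ (1 / H - 1 / H ^ 2) * (2 * sp * √(T / 2 * Real.log (2 / δ))) :=
          mul_le_mul_of_nonneg_left hε hH3
      _ ≤ 2 * sp * √(T / 2 * Real.log (2 / δ)) :=
          mul_le_of_le_one_left (by positivity) (by linarith)
      _ ≤ _ := e5
  have : 0 ≤ sp * √(T * Real.log (1 / δ)) := by positivity
  have : 0 ≤ sp * z := by positivity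
  -- The total is at most 5 R + 36 sp z + 2 sp √(T log (1/δ)), where 36 = 4·8 + 2 + 2.
  linarith

end Rate

/-- Only outcomes in the support matter, so off the bad set a history may be assumed to have length
`T` and to follow `act`. -/
theorem _root_.PMF.ofReal_one_sub_le {α : Type*} (p : PMF α) {s t : Set α} {δ : ℝ} (hδ : 0 ≤ δ)
    (hst : ∀ a ∈ p.support, a ∉ t → a ∈ s) (ht : p.toOuterMeasure t ≤ ENNReal.ofReal δ) :
    ENNReal.ofReal (1 - δ) ≤ p.toOuterMeasure s := by
  have h1 : p.toOuterMeasure (s ∪ t) = 1 := by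
    rw [PMF.toOuterMeasure_apply_eq_one_iff]
    intro a ha
    by_cases h : a ∈ t
    · exact Or.inr h
    · exact Or.inl (hst a ha h)
  rw [ENNReal.ofReal_sub _ hδ, ENNReal.ofReal_one, tsub_le_iff_right, ← h1]
  exact (MeasureTheory.measure_union_le s t).trans (by gcongr)

variable {S A : Type*} [Fintype S] [Fintype A] [DecidableEq S] [DecidableEq A]
  [Nonempty S] [Nonempty A]

theorem historyLaw_not_noiseBounded_le (M : MDP S A) (act : List (S × A) → S → A) (s₁ : S)
    {V : S → ℝ} {m sp H δ : ℝ} {T : ℕ} (hsp : 0 < sp) (hH : 1 ≤ H) (hδ0 : 0 < δ) (hδ1 : δ < 1)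
    (hT : (Fintype.card S * Fintype.card A : ℝ) ≤ T) (hT1 : 1 ≤ T)
    (hV : ∀ s, V s ∈ Set.Icc m (m + 2 * sp)) :
    (M.historyLaw act s₁ T).toOuterMeasure
      {h | h.1.length = T ∧ ¬ NoiseBounded M V sp H δ T h.1 h.2} ≤ ENNReal.ofReal (δ / 2) := by
  have hT0 : (1 : ℝ) ≤ T := by exact_mod_cast hT1
  have hLe : 1 ≤ 2 * T / δ := by rw [le_div_iff₀ hδ0]; linarith
  have hL := Real.log_nonneg hLe
  -- The tail bound is for upper deviations, hence the negated weights. The index `τ` stands for `τ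
  -- + 1` visits.
  let B : (S × A) → ℕ → Set (List (S × A) × S) := fun x τ =>
    {h | bonusCoeff sp H δ T / √((τ + 1 : ℕ) : ℝ) ≤
        M.noise V (fun past y => -visitWeight (stepWeight H (τ + 1)) x past y) h.1 h.2 ∧
      quadVar (fun past y => -visitWeight (stepWeight H (τ + 1)) x past y) h.1 ≤
        2 * H / ((τ + 1 : ℕ) : ℝ) ∧
      0 ≤ bonusCoeff sp H δ T / √((τ + 1 : ℕ) : ℝ)}
  have hB : ∀ x τ, (M.historyLaw act s₁ T).toOuterMeasure (B x τ) ≤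
      ENNReal.ofReal ((δ / (2 * T)) ^ 4) := by
    intro x τ
    have hτ : (0 : ℝ) < ((τ + 1 : ℕ) : ℝ) := by positivity
    refine (M.historyLaw_noise_le act s₁ T V (by positivity : 0 < 2 * sp) hV _
      (by positivity)).trans_eq ?_
    congr 1
    -- With range 2 sp and quadratic variation 2H/(τ+1), the factor 4 in the bonus gives exponent
    -- 2·16/(4·2) = 4 times the logarithm.
    have e : 2 * (bonusCoeff sp H δ T / √((τ + 1 : ℕ) : ℝ)) ^ 2 /
        ((2 * sp) ^ 2 * (2 * H / ((τ + 1 : ℕ) : ℝ))) = (4 : ℕ) * Real.log (2 * T / δ) := by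
      rw [bonusCoeff, div_pow, mul_pow, Real.sq_sqrt hτ.le, Real.sq_sqrt (by positivity)]
      push_cast
      field_simp
      ring
    rw [e, ← mul_neg, Real.exp_nat_mul, ← Real.log_inv, Real.exp_log (by positivity), inv_div]
  have hsub : {h : List (S × A) × S | h.1.length = T ∧ ¬ NoiseBounded M V sp H δ T h.1 h.2} ⊆
      ⋃ p ∈ (Finset.univ : Finset (S × A)) ×ˢ Finset.range T, B p.1 p.2 := by
    rintro ⟨l, s⟩ ⟨h1, h2⟩
    simp only [NoiseBounded, not_forall, not_le] at h2
    obtain ⟨x, τ, hτ, hτl, h3⟩ := h2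
    obtain ⟨τ, rfl⟩ := Nat.exists_eq_succ_of_ne_zero hτ.ne'
    have hle : τ + 1 ≤ T := hτl.trans (List.count_le_length.trans h1.le)
    simp only [Set.mem_iUnion]
    refine ⟨(x, τ), by simpa using hle, ?_, ?_, ?_⟩
    · rw [noise_neg]
      simp only [Nat.succ_eq_add_one] at h3
      linarith
    · rw [quadVar_neg, le_div_iff₀ (by positivity), mul_comm]
      exact mul_quadVar_stepWeight_le hH (τ + 1) x l
    · unfold bonusCoeff
      positivity
  refine (MeasureTheory.measure_mono hsub).trans
    ((MeasureTheory.measure_biUnion_finset_le _ _).trans ?_)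
  refine (Finset.sum_le_sum fun p _ => hB p.1 p.2).trans ?_
  rw [Finset.sum_const, Finset.card_product, Finset.card_range, Finset.card_univ,
    Fintype.card_prod, nsmul_eq_mul, ← ENNReal.ofReal_natCast, ← ENNReal.ofReal_mul (by positivity)]
  refine ENNReal.ofReal_le_ofReal ?_
  push_cast
  -- Since SA ≤ T, there are at most T² events in the union.
  calc (Fintype.card S * Fintype.card A : ℝ) * T * (δ / (2 * T)) ^ 4
      ≤ T * T * (δ / (2 * T)) ^ 4 := by gcongr
    _ = δ / 2 * (δ ^ 3 / (8 * T ^ 2)) := by field_simp; ring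
    _ ≤ δ / 2 * 1 := by
        gcongr
        rw [div_le_one (by positivity)]
        have : δ ^ 3 ≤ 1 := pow_le_one₀ hδ0.le hδ1.le
        nlinarith
    _ = δ / 2 := mul_one _

/-- The high-probability regret bound. -/
theorem historyLaw_regret_le (M : MDP S A) {J : ℝ} {q : S → A → ℝ} (hq : M.IsBellmanPair J q)
    (T : ℕ) {δ : ℝ} (hδ0 : 0 < δ) (hδ1 : δ < 1) {sp H : ℝ} (hspan : sp = span (maxValue q))
    (hH : H = horizon (Fintype.card S) (Fintype.card A) sp δ T) (h2 : 2 ≤ H)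
    {act : List (S × A) → S → A} (hact : IsGreedy M.r sp H δ T act) (s₁ : S) :
    ENNReal.ofReal (1 - δ) ≤ (M.historyLaw act s₁ T).toOuterMeasure
      {h | M.regret J h.1 ≤ 36 * rate (Fintype.card S) (Fintype.card A) sp δ T} := by
  have hS : 1 ≤ Fintype.card S := Fintype.card_pos
  have hA : 1 ≤ Fintype.card A := Fintype.card_pos
  obtain ⟨hsp, hL, hT⟩ := large_of_two_le_horizon hS hA hδ0 hδ1 (hH ▸ h2)
  have hN : (1 : ℝ) ≤ Fintype.card S * Fintype.card A := by
    exact_mod_cast Nat.one_le_iff_ne_zero.2 (by positivity)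
  have hNT : (Fintype.card S * Fintype.card A : ℝ) ≤ T := by nlinarith
  have hT1 : (1 : ℝ) ≤ T := hN.trans hNT
  have hH1 : 1 ≤ H := by linarith
  have hH0 : 0 < H := by linarith
  have hL' : 0 ≤ Real.log (2 * T / δ) := Real.log_nonneg (by rw [le_div_iff₀ hδ0]; linarith)
  have hγ0 : 0 ≤ 1 - 1 / H := by rw [sub_nonneg, div_le_one hH0]; exact hH1
  have hγ1 : 1 - 1 / H < 1 := by
    have : 0 < 1 / H := by positivity
    linarith
  obtain ⟨V, hV⟩ := M.exists_isDiscountedValue hγ0 hγ1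
  have hVI := hV.mem_Icc_of_bellman (by linarith) hq.bellman
  rw [← hspan] at hVI
  have hV0 := hV.nonneg hγ0 hγ1
  have hVH : ∀ s, V s ≤ H := fun s => by
    have := hV.one_sub_mul_le_one hγ0 hγ1 s
    rwa [sub_sub_cancel, one_div, inv_mul_le_iff₀ hH0, mul_one] at this
  have hJ : ∀ s, J ≤ 1 / H * V s + sp / H := fun s => by
    rw [one_div_mul_eq_div, ← add_div, le_div_iff₀ hH0]
    linarith [(hVI s).1]
  have hVc : ∀ s, V s ∈ Set.Icc (H * J - sp) (H * J - sp + 2 * sp) := fun s =>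
    ⟨(hVI s).1, (hVI s).2.trans_eq (by ring)⟩
  set ε := 2 * sp * √(T / 2 * Real.log (2 / δ)) with hε
  have hlog : 0 ≤ Real.log (2 / δ) := Real.log_nonneg (by rw [le_div_iff₀ hδ0]; linarith)
  refine PMF.ofReal_one_sub_le _ (t :=
    {h | h.1.length = T ∧ ¬ NoiseBounded M V sp H δ T h.1 h.2} ∪
    {h | ε ≤ M.noise V (fun _ _ => 1) h.1 h.2 ∧ quadVar (fun _ _ => 1) h.1 ≤ (T : ℝ) ∧ 0 ≤ ε})
    hδ0.le ?_ ?_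
  · rintro h hh hnot
    obtain ⟨hlen, hplay⟩ := M.mem_support_historyLaw act s₁ T h hh
    simp only [Set.mem_union, Set.mem_ofPred_eq, not_or, not_and, not_not] at hnot
    have hnoise : M.noise V (fun _ _ => 1) h.1 h.2 ≤ ε := by
      by_contra hlt
      refine hnot.2 (not_le.1 hlt).le ?_ (by positivity)
      rw [quadVar_one, hlen]
    refine (regret_le hH1 hsp.le hL' hV hV0 hVH hJ hact h.1 h.2 hplay (hnot.1 hlen)).trans ?_
    rw [hlen]
    exact regret_terms_le_rate hS hA hδ0 hδ1 hH h2 hnoise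
  · refine (MeasureTheory.measure_union_le _ _).trans ?_
    rw [← add_halves δ, ENNReal.ofReal_add (by positivity) (by positivity), add_halves]
    refine add_le_add (historyLaw_not_noiseBounded_le M act s₁ hsp hH1 hδ0 hδ1 hNT
      (by exact_mod_cast hT1) hVc) ?_
    refine (M.historyLaw_noise_le act s₁ T V (by positivity : 0 < 2 * sp) hVc _
      (by positivity)).trans_eq ?_
    congr 1
    have e : 2 * ε ^ 2 / ((2 * sp) ^ 2 * T) = Real.log (2 / δ) := by
      rw [hε, mul_pow, Real.sq_sqrt (by positivity)]
      field_simp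
    rw [e, ← Real.log_inv, Real.exp_log (by positivity), inv_div]

end OptimisticQ

end RegretBound

/-! ### Existence of a Bellman pair by vanishing discount. -/

section OptimalityEquation

open Filter Topology

namespace MDP

variable {S A : Type*} [Fintype S]

theorem nextValue_neg (M : MDP S A) (V : S → ℝ) (s : S) (a : A) :
    M.nextValue (fun u => -V u) s a = -M.nextValue V s a := by
  simp only [nextValue, mul_neg, Finset.sum_neg_distrib]

section Chain

variable [DecidableEq S] (M : MDP S A) (π : S → A)

theorem transMatrix_pow_nonneg (n : ℕ) (s u : S) : 0 ≤ (M.transMatrix π ^ n) s u := by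
  induction n generalizing u with
  | zero => rw [pow_zero, Matrix.one_apply]; split_ifs <;> norm_num
  | succ n ih =>
    rw [pow_succ, Matrix.mul_apply]
    exact Finset.sum_nonneg fun x _ => mul_nonneg (ih x) ENNReal.toReal_nonneg

theorem sum_transMatrix_pow_succ_mul (n : ℕ) (s : S) (v : S → ℝ) :
    ∑ u, (M.transMatrix π ^ (n + 1)) s u * v u =
      ∑ u, (M.transMatrix π ^ n) s u * M.nextValue v u (π u) := by
  simp only [pow_succ, Matrix.mul_apply, Finset.sum_mul, nextValue, Finset.mul_sum, transMatrix]
  rw [Finset.sum_comm]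
  simp only [mul_assoc]

theorem sum_transMatrix_pow (n : ℕ) (s : S) : ∑ u, (M.transMatrix π ^ n) s u = 1 := by
  induction n with
  | zero => simp [Matrix.one_apply]
  | succ n ih =>
    have := M.sum_transMatrix_pow_succ_mul π n s (fun _ => 1)
    simp only [nextValue_const, mul_one] at this
    rw [this, ih]

theorem mul_le_transMatrix_pow_add (m n : ℕ) (s x u : S) :
    (M.transMatrix π ^ m) s x * (M.transMatrix π ^ n) x u ≤ (M.transMatrix π ^ (m + n)) s u := by
  rw [pow_add, Matrix.mul_apply]
  exact Finset.single_le_sum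
    (f := fun x => (M.transMatrix π ^ m) s x * (M.transMatrix π ^ n) x u)
    (fun y _ => mul_nonneg (M.transMatrix_pow_nonneg π m s y) (M.transMatrix_pow_nonneg π n y u))
    (Finset.mem_univ x)

theorem IsAccessible.refl (s : S) : M.IsAccessible π s s := ⟨0, by simp⟩

variable {M π}

theorem IsAccessible.trans {s x u : S} (h1 : M.IsAccessible π s x) (h2 : M.IsAccessible π x u) :
    M.IsAccessible π s u := by
  obtain ⟨m, hm⟩ := h1
  obtain ⟨n, hn⟩ := h2
  exact ⟨m + n, (mul_pos hm hn).trans_le (M.mul_le_transMatrix_pow_add π m n s x u)⟩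

theorem IsAccessible.reflTransGen {s u : S} (h : M.IsAccessible π s u) :
    Relation.ReflTransGen (fun x y => 0 < M.transMatrix π x y) s u := by
  obtain ⟨n, hn⟩ := h
  induction n generalizing u with
  | zero =>
    rw [pow_zero, Matrix.one_apply] at hn
    split_ifs at hn with hsu
    · rw [hsu]
    · exact absurd hn (lt_irrefl _)
  | succ n ih =>
    rw [pow_succ, Matrix.mul_apply] at hn
    obtain ⟨x, -, hx⟩ := Finset.exists_lt_of_sum_lt (f := fun _ => (0 : ℝ)) (by simpa using hn)
    have h1 := pos_of_mul_pos_left hx ENNReal.toReal_nonneg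
    have h2 := pos_of_mul_pos_right hx (M.transMatrix_pow_nonneg π n s x)
    exact (ih h1).tail h2

variable (M π)

/-- A finite chain reaches a non-transient state from everywhere. -/
theorem exists_isAccessible_not_isTransient (s : S) :
    ∃ u, M.IsAccessible π s u ∧ ¬ M.IsTransient π u := by
  classical
  -- A state with the fewest accessible states lies in a closed communicating class.
  obtain ⟨u, hu, hmin⟩ := Set.exists_min_image {u | M.IsAccessible π s u}
    (fun u => {x | M.IsAccessible π u x}.ncard) (Set.toFinite _) ⟨s, IsAccessible.refl M π s⟩
  have hback : ∀ x, M.IsAccessible π u x → M.IsAccessible π x u := by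
    intro x hx
    have hsub : {y | M.IsAccessible π x y} ⊆ {y | M.IsAccessible π u y} := fun y hy => hx.trans hy
    have heq := Set.eq_of_subset_of_ncard_le hsub (hmin x (IsAccessible.trans hu hx))
      (Set.toFinite _)
    have : u ∈ {y | M.IsAccessible π u y} := IsAccessible.refl M π u
    rwa [← heq] at this
  refine ⟨u, hu, fun htr => ?_⟩
  -- Were `u` transient, visits from `u` to every state would be summable, yet the probabilities at
  -- each time add up to 1.
  have hsum : ∀ x, Summable fun n : ℕ => (M.transMatrix π ^ n) u x := by
    intro x
    by_cases hx : M.IsAccessible π u x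
    · obtain ⟨j, hj⟩ := hback x hx
      have h1 : Summable fun n : ℕ => (M.transMatrix π ^ (n + j)) u u :=
        (summable_nat_add_iff j).2 htr
      refine Summable.of_nonneg_of_le (fun n => M.transMatrix_pow_nonneg π n u x) (fun n => ?_)
        (h1.mul_right ((M.transMatrix π ^ j) x u)⁻¹)
      rw [← div_eq_mul_inv, le_div_iff₀ hj]
      exact M.mul_le_transMatrix_pow_add π n j u x u
    · have : ∀ n : ℕ, (M.transMatrix π ^ n) u x = 0 := fun n =>
        le_antisymm (not_lt.1 fun h => hx ⟨n, h⟩) (M.transMatrix_pow_nonneg π n u x)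
      simp only [this]
      exact summable_zero
  have h2 := summable_sum fun x (_ : x ∈ Finset.univ) => hsum x
  simp only [sum_transMatrix_pow] at h2
  exact one_ne_zero (tendsto_nhds_unique tendsto_const_nhds h2.tendsto_atTop_zero)

end Chain

/-- If `W` does not increase by more than `1` on average under the available actions, then its
values at states accessible from a minimizer exceed the minimum by a bounded amount only. -/
theorem exists_bound_of_reflTransGen (M : MDP S A) (act : S → A → Prop) {s u : S}
    (h : Relation.ReflTransGen (fun x y => ∃ a, act x a ∧ 0 < (M.p x a y).toReal) s u) :
    ∃ c, ∀ W : S → ℝ, (∀ x a, act x a → M.nextValue W x a ≤ W x + 1) → (∀ x, W s ≤ W x) →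
      W u ≤ W s + c := by
  -- Later states on the path need not minimize `W`, so the induction uses an arbitrary lower bound
  -- `m`; κ is the product of the transition probabilities along the path.
  suffices H : ∃ κ > 0, ∃ c, ∀ W : S → ℝ, (∀ x a, act x a → M.nextValue W x a ≤ W x + 1) →
      ∀ m, (∀ x, m ≤ W x) → κ * (W u - m) ≤ W s - m + c by
    obtain ⟨κ, hκ, c, hc⟩ := H
    refine ⟨c / κ, fun W hW hs => ?_⟩
    have h1 := hc W hW (W s) hs
    rw [← sub_le_iff_le_add', le_div_iff₀ hκ]
    linarith
  induction h using Relation.ReflTransGen.head_induction_on with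
  | refl => exact ⟨1, one_pos, 0, fun W _ m _ => by simp⟩
  | @head x y hxy _ ih =>
    obtain ⟨κ, hκ, c, hc⟩ := ih
    obtain ⟨a, ha, hp⟩ := hxy
    refine ⟨(M.p x a y).toReal * κ, mul_pos hp hκ, (M.p x a y).toReal * c + 1,
      fun W hW m hm => ?_⟩
    have h1 := mul_le_mul_of_nonneg_left (hc W hW m hm) hp.le
    have h2 := hW x a ha
    have h3 : (M.p x a y).toReal * (W y - m) ≤ M.nextValue W x a + -m := by
      rw [← nextValue_add_const]
      exact Finset.single_le_sum (f := fun z => (M.p x a z).toReal * (W z + -m))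
        (fun z _ => mul_nonneg ENNReal.toReal_nonneg (by linarith [hm z])) (Finset.mem_univ y)
    linarith

section Verification

variable [DecidableEq S] {M : MDP S A} {J : ℝ} {v : S → ℝ}

/-- Telescoping `v` along the chain turns one-step Bellman inequalities into bounds on total reward,
up to boundary terms. -/
theorem sum_expectedReward_add (M : MDP S A) (π : S → A) (v : S → ℝ) (s : S) (T : ℕ) :
    ∑ t ∈ Finset.range T, M.expectedReward π t s + ∑ u, (M.transMatrix π ^ T) s u * v u = v s +
      ∑ t ∈ Finset.range T, ∑ u, (M.transMatrix π ^ t) s u *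
        (M.r u (π u) + M.nextValue v u (π u) - v u) := by
  induction T with
  | zero => simp [Matrix.one_apply]
  | succ T ih =>
    rw [Finset.sum_range_succ, Finset.sum_range_succ, sum_transMatrix_pow_succ_mul, expectedReward]
    simp only [mul_sub, mul_add, Finset.sum_sub_distrib, Finset.sum_add_distrib] at ih ⊢
    linarith

theorem abs_sum_transMatrix_pow_mul_le (M : MDP S A) (π : S → A) (v : S → ℝ) (s : S) (T : ℕ) :
    |∑ u, (M.transMatrix π ^ T) s u * v u| ≤ ‖v‖ := by
  refine (Finset.abs_sum_le_sum_abs _ _).trans ?_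
  calc ∑ u, |(M.transMatrix π ^ T) s u * v u| ≤ ∑ u, (M.transMatrix π ^ T) s u * ‖v‖ := by
        refine Finset.sum_le_sum fun u _ => ?_
        rw [abs_mul, abs_of_nonneg (M.transMatrix_pow_nonneg π T s u)]
        exact mul_le_mul_of_nonneg_left (norm_le_pi_norm v u) (M.transMatrix_pow_nonneg π T s u)
    _ = ‖v‖ := by rw [← Finset.sum_mul, sum_transMatrix_pow, one_mul]

theorem tendsto_add_div_nat (J c : ℝ) :
    Tendsto (fun T : ℕ => J + c / (T : ℝ)) atTop (𝓝 J) := by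
  simpa using (tendsto_const_div_atTop_nhds_zero_nat c).const_add J

theorem avgReward_le (h : ∀ s a, M.r s a + M.nextValue v s a ≤ J + v s) (π : S → A) (s : S) :
    M.avgReward π s ≤ J := by
  have hle : ∀ T : ℕ, 0 < T → (1 / (T : ℝ)) * ∑ t ∈ Finset.range T, M.expectedReward π t s ≤
      J + (2 * ‖v‖) / (T : ℝ) := by
    intro T hT
    have hT0 : (0 : ℝ) < T := by exact_mod_cast hT
    have h1 := M.sum_expectedReward_add π v s T
    have h2 := (abs_le.1 (M.abs_sum_transMatrix_pow_mul_le π v s T)).1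
    have h3 := (le_abs_self (v s)).trans (norm_le_pi_norm v s)
    have h4 : ∑ t ∈ Finset.range T, ∑ u, (M.transMatrix π ^ t) s u *
        (M.r u (π u) + M.nextValue v u (π u) - v u) ≤ ∑ _t ∈ Finset.range T, J := by
      refine Finset.sum_le_sum fun t _ => ?_
      calc _ ≤ ∑ u, (M.transMatrix π ^ t) s u * J :=
            Finset.sum_le_sum fun u _ => mul_le_mul_of_nonneg_left
              (by linarith [h u (π u)]) (M.transMatrix_pow_nonneg π t s u)
        _ = J := by rw [← Finset.sum_mul, sum_transMatrix_pow, one_mul]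
    rw [Finset.sum_const, Finset.card_range, nsmul_eq_mul] at h4
    rw [one_div_mul_eq_div, div_le_iff₀ hT0, add_mul, div_mul_cancel₀ _ hT0.ne']
    linarith
  have hlim := tendsto_add_div_nat J (2 * ‖v‖)
  refine le_trans (liminf_le_liminf ?_ ?_ ?_) hlim.liminf_eq.le
  · filter_upwards [eventually_gt_atTop 0] with T hT using hle T hT
  · refine isBoundedUnder_of ⟨0, fun T => ?_⟩
    refine mul_nonneg (by positivity : (0 : ℝ) ≤ 1 / (T : ℝ)) (Finset.sum_nonneg fun t _ => Finset.sum_nonneg fun u _ => ?_)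
    exact mul_nonneg (M.transMatrix_pow_nonneg π t s u) (M.r_mem u (π u)).1
  · exact hlim.isCoboundedUnder_ge

theorem avgReward_eq {π : S → A}
    (h : ∀ s, M.r s (π s) + M.nextValue v s (π s) = J + v s) (s : S) :
    M.avgReward π s = J := by
  refine Tendsto.liminf_eq (tendsto_iff_dist_tendsto_zero.2 ?_)
  refine squeeze_zero' (Eventually.of_forall fun T => dist_nonneg) ?_
    (tendsto_add_div_nat (0 : ℝ) (2 * ‖v‖))
  filter_upwards [eventually_gt_atTop 0] with T hT
  have hT0 : (0 : ℝ) < T := by exact_mod_cast hT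
  have h1 := M.sum_expectedReward_add π v s T
  have h2 := abs_le.1 (M.abs_sum_transMatrix_pow_mul_le π v s T)
  have h3 := abs_le.1 (norm_le_pi_norm v s : |v s| ≤ ‖v‖)
  simp only [h, add_sub_cancel_right, ← Finset.sum_mul, sum_transMatrix_pow, one_mul,
    Finset.sum_const, Finset.card_range, nsmul_eq_mul] at h1
  rw [Real.dist_eq, zero_add, one_div_mul_eq_div, div_sub' hT0.ne', abs_div, abs_of_pos hT0]
  gcongr
  rw [abs_le]
  constructor <;> linarith

end Verification

variable [DecidableEq S] [Finite A]

/-- In a weakly communicating MDP, the approximate solutions of the average-reward optimality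
equation have bounded span. -/
theorem IsWeaklyCommunicating.exists_span_bound [Nonempty S] {M : MDP S A}
    (hM : M.IsWeaklyCommunicating) :
    ∃ c, ∀ V : S → ℝ, (∀ s a, M.nextValue V s a ≤ V s + 1) →
      (∀ s, ∃ a, V s ≤ M.nextValue V s a + 1) → ∀ s s', V s ≤ V s' + c := by
  obtain ⟨C, hC, hacc⟩ := hM
  have hreach : ∀ (π : S → A) (s : S), ∃ u ∈ C, M.IsAccessible π s u := by
    intro π s
    obtain ⟨u, hu, hnt⟩ := M.exists_isAccessible_not_isTransient π s
    exact ⟨u, by_contra fun h => hnt (hC u h π), hu⟩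
  have hpath : ∀ (π : S → A) {s u : S}, M.IsAccessible π s u → Relation.ReflTransGen
      (fun x y => ∃ a, a = π x ∧ 0 < (M.p x a y).toReal) s u := fun π s u h =>
    h.reflTransGen.lift id fun x _ hxy => ⟨π x, rfl, hxy⟩
  choose g hgC hg using hreach
  choose c₂ hc₂ using fun (p : (S → A) × S) =>
    M.exists_bound_of_reflTransGen (fun x a => a = p.1 x) (hpath p.1 (hg p.1 p.2))
  have hup : ∀ p : S × S, ∃ c, p.2 ∈ C → ∀ W : S → ℝ,
      (∀ x a, True → M.nextValue W x a ≤ W x + 1) → (∀ x, W p.1 ≤ W x) →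
        W p.2 ≤ W p.1 + c := by
    rintro ⟨s, u⟩
    by_cases hu : u ∈ C
    · by_cases hA : Nonempty (S → A)
      · obtain ⟨π⟩ := hA
        obtain ⟨π', h'⟩ := hacc _ (hgC π s) u hu
        have key : Relation.ReflTransGen
            (fun x y => ∃ a, True ∧ 0 < (M.p x a y).toReal) s u :=
          ((hpath π (hg π s)).lift id fun _ _ ⟨a, _, h⟩ => ⟨a, trivial, h⟩).trans
            ((hpath π' h').lift id fun _ _ ⟨a, _, h⟩ => ⟨a, trivial, h⟩)
        obtain ⟨c, hc⟩ := M.exists_bound_of_reflTransGen (fun _ _ => True) key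
        exact ⟨c, fun _ => hc⟩
      · obtain ⟨π', -⟩ := hacc u hu u hu
        exact absurd ⟨π'⟩ hA
    · exact ⟨0, fun h => absurd h hu⟩
  choose c₁ hc₁ using hup
  -- The constants depend only on pairs of states, or on a policy and a state. There are finitely
  -- many of these, so the bound is uniform in `V`.
  refine ⟨(⨆ p, c₁ p) + ⨆ p, c₂ p, fun V hV1 hV2 s s' => ?_⟩
  choose π hπ using hV2
  obtain ⟨lo, hlo⟩ := Finite.exists_min V
  obtain ⟨hi, hhi⟩ := Finite.exists_max V
  -- The state `g π hi` in `C` links the extremes: `V` there is not far above its minimum, as it is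
  -- accessible from `lo`, nor far below its maximum, as `π` leads there from `hi`.
  have e1 := hc₁ (lo, g π hi) (hgC π hi) V (fun x a _ => hV1 x a) hlo
  have e2 := hc₂ (π, hi) (fun x => -V x) (fun x a ha => by
    rw [nextValue_neg, ha]; linarith [hπ x]) (fun x => neg_le_neg (hhi x))
  have e3 := le_ciSup_fintype c₁ (lo, g π hi)
  have e4 := le_ciSup_fintype c₂ (π, hi)
  have e5 := hhi s
  have e6 := hlo s'
  dsimp only at e1 e2
  linarith

variable [Nonempty S] [Nonempty A]

/-- The average-reward optimality equation has a solution, a limit of discounted values. -/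
theorem IsWeaklyCommunicating.exists_optimality_equation {M : MDP S A}
    (hM : M.IsWeaklyCommunicating) :
    ∃ (J : ℝ) (v : S → ℝ), (∀ s a, M.r s a + M.nextValue v s a ≤ J + v s) ∧
      ∀ s, ∃ a, J + v s = M.r s a + M.nextValue v s a := by
  obtain ⟨c, hc⟩ := hM.exists_span_bound
  obtain ⟨s₀⟩ := ‹Nonempty S›
  have : Nonempty S := ⟨s₀⟩
  let γ : ℕ → ℝ := fun n => 1 - 1 / ((n : ℝ) + 1)
  have hγ0 : ∀ n, 0 ≤ γ n := fun n => by
    simp only [γ, sub_nonneg]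
    rw [div_le_one (by positivity)]
    linarith [(n.cast_nonneg : (0 : ℝ) ≤ n)]
  have hγ1 : ∀ n, γ n < 1 := fun n => by
    have : 0 < 1 / ((n : ℝ) + 1) := by positivity
    simp only [γ]
    linarith
  have hγ : Tendsto γ atTop (𝓝 1) := by
    simpa [γ] using (tendsto_one_div_add_atTop_nhds_zero_nat (𝕜 := ℝ)).const_sub 1
  choose V hV using fun n => M.exists_isDiscountedValue (hγ0 n) (hγ1 n)
  have hV0 := fun n => (hV n).nonneg (hγ0 n) (hγ1 n)
  have hV1 := fun n => (hV n).one_sub_mul_le_one (hγ0 n) (hγ1 n)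
  have hEV0 : ∀ n s a, 0 ≤ M.nextValue (V n) s a := fun n s a => by
    simpa [nextValue_const] using M.nextValue_mono (hV0 n) s a
  have hEV1 : ∀ n s a, (1 - γ n) * M.nextValue (V n) s a ≤ 1 := fun n s a => by
    have h1 : 0 < 1 - γ n := by linarith [hγ1 n]
    have h2 := M.nextValue_mono (U := V n) (V := fun _ => 1 / (1 - γ n)) (fun u => by
      rw [le_div_iff₀ h1, mul_comm]; exact hV1 n u) s a
    rwa [nextValue_const, le_div_iff₀ h1, mul_comm] at h2
  have hspan : ∀ n s s', V n s ≤ V n s' + c := by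
    intro n
    refine hc (V n) (fun s a => ?_) fun s => ?_
    · have e1 := (hV n).le_value s a
      have e2 := hEV1 n s a
      have e3 := (M.r_mem s a).1
      linarith
    · obtain ⟨a, ha⟩ := (hV n).exists_eq s
      refine ⟨a, ?_⟩
      have e2 := mul_nonneg (sub_nonneg.2 (hγ1 n).le) (hEV0 n s a)
      have e3 := (M.r_mem s a).2
      linarith
  -- Normalized gains and relative values lie in a fixed compact box by the span bound.
  let x : ℕ → ℝ × (S → ℝ) := fun n => ((1 - γ n) * V n s₀, fun s => V n s + -V n s₀)
  have hx : ∀ n, x n ∈ Set.Icc (0 : ℝ) 1 ×ˢ Set.Icc (fun _ : S => -c) (fun _ => c) := fun n =>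
    ⟨⟨mul_nonneg (sub_nonneg.2 (hγ1 n).le) (hV0 n s₀), hV1 n s₀⟩,
      fun s => by simp only [x]; linarith [hspan n s₀ s],
      fun s => by simp only [x]; linarith [hspan n s s₀]⟩
  obtain ⟨⟨J, v⟩, -, φ, hφ, hlim⟩ := (isCompact_Icc.prod isCompact_Icc).tendsto_subseq hx
  have hJ : Tendsto (fun n => (x (φ n)).1) atTop (𝓝 J) := (Prod.tendsto_iff _ _).1 hlim |>.1
  have hv : ∀ s, Tendsto (fun n => (x (φ n)).2 s) atTop (𝓝 (v s)) := fun s =>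
    (tendsto_pi_nhds.1 ((Prod.tendsto_iff _ _).1 hlim).2) s
  have hγφ := hγ.comp hφ.tendsto_atTop
  have hleft : ∀ s, Tendsto (fun n => (x (φ n)).1 + (x (φ n)).2 s) atTop (𝓝 (J + v s)) :=
    fun s => hJ.add (hv s)
  have hright : ∀ s a, Tendsto (fun n => M.r s a + γ (φ n) * M.nextValue (x (φ n)).2 s a) atTop
      (𝓝 (M.r s a + M.nextValue v s a)) := fun s a => by
    have h1 : Tendsto (fun n => M.nextValue (x (φ n)).2 s a) atTop (𝓝 (M.nextValue v s a)) :=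
      tendsto_finsetSum _ fun u _ => (hv u).const_mul _
    simpa using (hγφ.mul h1).const_add (M.r s a)
  have hshift : ∀ n s a, M.r s a + γ n * M.nextValue (x n).2 s a - ((x n).1 + (x n).2 s) =
      M.r s a + γ n * M.nextValue (V n) s a - V n s := fun n s a => by
    simp only [x, nextValue_add_const]
    ring
  refine ⟨J, v, fun s a => ?_, fun s => ?_⟩
  · refine le_of_tendsto_of_tendsto' (hright s a) (hleft s) fun n => ?_
    have e1 := (hV (φ n)).le_value s a
    have e2 := hshift (φ n) s a
    linarith
  -- If every action were strictly suboptimal in the limit, all would be so at a common `n`, as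
  -- there are finitely many; but the discounted equation is attained.
  · by_contra! hne
    have hlt : ∀ a, M.r s a + M.nextValue v s a < J + v s := fun a =>
      lt_of_le_of_ne (le_of_tendsto_of_tendsto' (hright s a) (hleft s) fun n => by
        have e1 := (hV (φ n)).le_value s a
        have e2 := hshift (φ n) s a
        linarith) (hne a).symm
    have hev := eventually_all.2 fun a => (hright s a).eventually_lt (hleft s) (hlt a)
    obtain ⟨n, hn⟩ := hev.exists
    obtain ⟨a, ha⟩ := (hV (φ n)).exists_eq s
    have e1 := hn a
    have e2 := hshift (φ n) s a
    linarith

theorem IsWeaklyCommunicating.exists_isBellmanPair {M : MDP S A}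
    (hM : M.IsWeaklyCommunicating) : ∃ (J : ℝ) (q : S → A → ℝ), M.IsBellmanPair J q := by
  obtain ⟨J, v, hle, heq⟩ := hM.exists_optimality_equation
  choose π hπ using heq
  have hmax : maxValue (fun s a => M.r s a + M.nextValue v s a - J) = v := by
    ext s
    refine le_antisymm (ciSup_le fun a => by linarith [hle s a]) ?_
    have := le_ciSup_fintype (fun a => M.r s a + M.nextValue v s a - J) (π s)
    simp only [maxValue]
    linarith [hπ s]
  refine ⟨J, fun s a => M.r s a + M.nextValue v s a - J, fun s => ?_, fun s a => ?_⟩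
  · refine le_antisymm (ciSup_le fun π' => avgReward_le hle π' s) ?_
    rw [← avgReward_eq (fun s => (hπ s).symm) s]
    exact le_ciSup_fintype (fun π' => M.avgReward π' s) π
  · rw [hmax, nextValue]
    ring

end MDP

end OptimalityEquation

theorem mainTheorem1 :
    ∃ K : ℝ, 0 < K ∧
      ∀ (S A : Type*) [Fintype S] [Fintype A] [DecidableEq S] [DecidableEq A]
        [Nonempty S] [Nonempty A] (M : MDP S A), M.IsWeaklyCommunicating →
        (∃ (J : ℝ) (q : S → A → ℝ), M.IsBellmanPair J q) ∧
        ∀ (J : ℝ) (q : S → A → ℝ), M.IsBellmanPair J q →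
          ∀ (T : ℕ) (δ : ℝ), 0 < δ → δ < 1 →
          ∀ (sp H : ℝ), sp = MDP.span (MDP.maxValue q) →
            H = OptimisticQ.horizon (Fintype.card S) (Fintype.card A) sp δ T → 2 ≤ H →
          ∀ (act : List (S × A) → S → A), OptimisticQ.IsGreedy M.r sp H δ T act →
          ∀ s₁ : S,
            ENNReal.ofReal (1 - δ) ≤
              (M.historyLaw act s₁ T).toOuterMeasure
                {h | M.regret J h.1 ≤
                  K * OptimisticQ.rate (Fintype.card S) (Fintype.card A) sp δ T} := by
  refine ⟨36, by norm_num, fun S A _ _ _ _ _ _ M hM => ⟨hM.exists_isBellmanPair, ?_⟩⟩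
  intro J q hq T δ hδ0 hδ1 sp H hsp hH h2 act hact s₁
  exact OptimisticQ.historyLaw_regret_le M hq T hδ0 hδ1 hsp hH h2 hact s₁
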